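/- Let $\Sigma$ be a smooth manifold of dimension $2n+1$ (not necessarily compact) with a contact form $\lambda$ whose Reeb vector field $R$ is complete, and let $\xi=\ker\lambda$, cooriented by $\lambda$. For a smooth function $F$ on $\Sigma$, the contact vector field of $F$ is the vector field $v$ preserving $\xi$ with $\lambda(v)=F$, and $F$ is called complete if $v$ is complete. Legendrian submanifolds ($n$-dimensional and tangent to $\xi$) are assumed to be compact. **Interlinking.** Given a contact form $\lambda'$ for $\xi$ with complete Reeb flow, a pair $(\Lambda_0,\Lambda_1)$ of disjoint Legendrians is interlinked for $\lambda'$ if there is $\mu=\mu(\Lambda_0,\Lambda_1,\lambda')>0$ such that for every $a>0$ and every complete bounded contact Hamiltonian $F$ with respect to $\lambda'$ with $F\ge a$, the flow of $F$ has an orbit of time-length $\le\mu/a$ that starts on $\Lambda_0$ and ends on $\Lambda_1$. It is robustly interlinked for $\lambda'$ if, moreover, all pairs of Legendrians from some $C^\infty$-neighbourhoods of $\Lambda_0$ and of $\Lambda_1$ are interlinked for $\lambda'$ (with constants that may depend on the pair). The pair is robustly interlinked in $(\Sigma,\xi)$ if it is so for every contact form $\lambda'=g\lambda$, $g>0$ smooth,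 whose Reeb flow is complete. **Theorem.** Let $H:\Sigma\to\mathbb R$ be a smooth function whose contact vector field $v$ is complete, with flow $\{\varphi^t\}$. Let $W$ be a connected component of $\{H>0\}$ whose boundary $M=\partial W$ is a smooth compact hypersurface. Put $$\Gamma=\{x\in M: d_xH(R)=0\},\quad M_-=\{x\in M: d_xH(R)<0\},\quad M_+=\{x\in M: d_xH(R)>0\}.$$ Assume $\spadesuit$: $\Gamma$ is a smooth hypersurface of $M$, and at each point of $\Gamma$ the field $v$ is transversal to $\Gamma$ and points into $M_-$, so that the trajectories of $v$ cross $\Gamma$ from $M_+$ into $M_-$ (for each $x\in\Gamma$ and all sufficiently small $t>0$ one has $\varphi^{t}(x)\in M_-$ and $\varphi^{-t}(x)\in M_+$). Assume that the core $Q_-=\bigcap_{s>0}\varphi^s(M_-)$ is a Legendrian submanifold $\Lambda$. Then for every Legendrian submanifold $K\subset W$ such that the pair $(K,\Lambda)$ is robustly interlinked in $(\Sigma,\xi)$, there is a point $x\in K$ whose semi-infinite trajectory $\varphi^t(x)$, $t\ge 0$, converges asymptotically to $\Lambda$ as $t\to+\infty$ (it is eventually in every neighbourhood of $\Lambda$).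 -/

import Mathlib

open Set Filter Topology
open scoped Manifold ContDiff

noncomputable section

namespace ContactDyn

variable {E : Type*} [NormedAddCommGroup E] [NormedSpace ℝ E]
  {X : Type*} [TopologicalSpace X] [ChartedSpace E X]

/-! ### Vector fields, flows, one-forms -/

variable (E X) in
/-- A (not necessarily smooth) vector field on `X`. -/
abbrev VField := (x : X) → TangentSpace 𝓘(ℝ, E) x

variable (E X) in
/-- A (not necessarily smooth) differential one-form on `X`. -/
abbrev OneForm := (x : X) → (TangentSpace 𝓘(ℝ, E) x →L[ℝ] ℝ)

/-- The vector field `v` is smooth. -/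
def SmoothField [IsManifold 𝓘(ℝ, E) ∞ X] (v : VField E X) : Prop :=
  ContMDiff 𝓘(ℝ, E) 𝓘(ℝ, E).tangent ∞
    (fun x => (⟨x, v x⟩ : TangentBundle 𝓘(ℝ, E) X))

/-- `v` is complete: through every point there is an integral curve defined for all times. -/
def CompleteField (v : VField E X) : Prop :=
  ∀ x : X, ∃ γ : ℝ → X, γ 0 = x ∧ IsMIntegralCurve γ v

/-- `φ` is the (complete, smooth) flow of the vector field `v`. -/
structure IsFlow (φ : ℝ → X → X) (v : VField E X) : Prop where
  smooth : ContMDiff (𝓘(ℝ, ℝ).prod 𝓘(ℝ, E)) 𝓘(ℝ, E) ∞ (fun p : ℝ × X => φ p.1 p.2)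
  map_zero : ∀ x, φ 0 x = x
  integral : ∀ x, IsMIntegralCurve (fun t => φ t x) v

/-- The function `H` is smooth. -/
def SmoothFun (E : Type*) [NormedAddCommGroup E] [NormedSpace ℝ E]
    {X : Type*} [TopologicalSpace X] [ChartedSpace E X] (H : X → ℝ) : Prop :=
  ContMDiff 𝓘(ℝ, E) 𝓘(ℝ, ℝ) ∞ H

/-- The differential `d_x H`, applied to a tangent vector. -/
def dFun (H : X → ℝ) (x : X) (u : TangentSpace 𝓘(ℝ, E) x) : ℝ :=
  mfderiv 𝓘(ℝ, E) 𝓘(ℝ, ℝ) H x u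

/-- The coordinate expression of the one-form `lam` in the chart centred at `c`, that is, the
pull-back of `lam` by the inverse of that chart. -/
def OneForm.inChart (lam : OneForm E X) (c : X) (y : E) : E →L[ℝ] ℝ :=
  (lam ((extChartAt 𝓘(ℝ, E) c).symm y)).comp
    (mfderiv 𝓘(ℝ, E) 𝓘(ℝ, E) (extChartAt 𝓘(ℝ, E) c).symm y)

/-- `lam` is smooth: its coordinate expressions are smooth. -/
def OneForm.Smooth (lam : OneForm E X) : Prop :=
  ∀ c : X, ContDiffOn ℝ ∞ (OneForm.inChart lam c) (extChartAt 𝓘(ℝ, E) c).target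

/-- The exterior derivative `(d lam)_x (u, w)`, computed in the chart at `x`, by which Mathlib
identifies the tangent space at `x` with the model space `E`:
`dω (u, w) = (D_u ω) w - (D_w ω) u`. -/
def OneForm.d (lam : OneForm E X) (x : X) (u w : TangentSpace 𝓘(ℝ, E) x) : ℝ :=
  let D : E →L[ℝ] (E →L[ℝ] ℝ) := fderiv ℝ (OneForm.inChart lam x) (extChartAt 𝓘(ℝ, E) x x)
  D u w - D w u

/-- The one-form `g lam`, for a function `g`. -/
def OneForm.rescale (g : X → ℝ) (lam : OneForm E X) : OneForm E X := fun x => g x • lam x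

/-! ### Contact geometry -/

/-- `lam` is a contact form: a smooth, nowhere vanishing one-form whose differential is
nondegenerate on the hyperplanes `ξ = ker lam`; in dimension `2n+1` this is the condition that
`lam ∧ (d lam)^n` is a volume form. -/
structure IsContactForm (lam : OneForm E X) : Prop where
  smooth : lam.Smooth
  ne_zero : ∀ x, lam x ≠ 0
  nondegenerate : ∀ x, ∀ u : TangentSpace 𝓘(ℝ, E) x, lam x u = 0 →
    (∀ w : TangentSpace 𝓘(ℝ, E) x, lam x w = 0 → lam.d x u w = 0) → u = 0

/-- `R` is the Reeb vector field of `lam`. -/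
structure IsReeb [IsManifold 𝓘(ℝ, E) ∞ X] (lam : OneForm E X) (R : VField E X) : Prop where
  smooth : SmoothField R
  normalized : ∀ x, lam x (R x) = 1
  kernel : ∀ x w, lam.d x (R x) w = 0

/-- `v` is the contact vector field with contact Hamiltonian `H`: `lam v = H`, and `v` preserves
`ξ = ker lam`, that is, the Lie derivative of `lam` along `v`, which by Cartan's formula is
`d lam (v, ·) + d (lam v)`, is at each point a multiple of `lam`. -/
structure IsContactField [IsManifold 𝓘(ℝ, E) ∞ X] (lam : OneForm E X) (H : X → ℝ)
    (v : VField E X) : Prop where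
  smooth : SmoothField v
  hamiltonian : ∀ x, lam x (v x) = H x
  preserves : ∀ x, ∃ c : ℝ, ∀ w : TangentSpace 𝓘(ℝ, E) x,
    lam.d x (v x) w + dFun H x w = c * lam x w

/-! ### Submanifolds -/

/-- On the open set `U`, the set `S` is the zero set of the submersion `f` to `ℝᵏ`. -/
structure IsDefiningMap {k : ℕ} (E : Type*) [NormedAddCommGroup E] [NormedSpace ℝ E]
    {X : Type*} [TopologicalSpace X] [ChartedSpace E X]
    (S U : Set X) (f : X → EuclideanSpace ℝ (Fin k)) : Prop where
  isOpen : IsOpen U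
  smooth : ContMDiffOn 𝓘(ℝ, E) 𝓘(ℝ, EuclideanSpace ℝ (Fin k)) ∞ f U
  submersion : ∀ x ∈ U,
    Function.Surjective (mfderiv 𝓘(ℝ, E) 𝓘(ℝ, EuclideanSpace ℝ (Fin k)) f x)
  zeros : ∀ x ∈ U, (x ∈ S ↔ f x = 0)

/-- `S` is a smooth (embedded) submanifold of codimension `k`. -/
def IsSubmanifold (E : Type*) [NormedAddCommGroup E] [NormedSpace ℝ E]
    {X : Type*} [TopologicalSpace X] [ChartedSpace E X] (k : ℕ) (S : Set X) : Prop :=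
  ∀ x ∈ S, ∃ (U : Set X) (f : X → EuclideanSpace ℝ (Fin k)), x ∈ U ∧ IsDefiningMap E S U f

/-- `u` is tangent at `x` to the submanifold `S` of codimension `k`: it is in the kernel of the
differential of a local defining map (this kernel does not depend on the choice of the map). -/
def TangentTo (k : ℕ) (S : Set X) (x : X) (u : TangentSpace 𝓘(ℝ, E) x) : Prop :=
  ∃ (U : Set X) (f : X → EuclideanSpace ℝ (Fin k)), x ∈ U ∧ IsDefiningMap E S U f ∧
    mfderiv 𝓘(ℝ, E) 𝓘(ℝ, EuclideanSpace ℝ (Fin k)) f x u = 0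

/-- `S` is a compact Legendrian submanifold of the contact manifold `(X, ker lam)` of dimension
`2n+1`: an `n`-dimensional submanifold, hence of codimension `n+1`, tangent to `ker lam`. -/
structure IsLegendrian (n : ℕ) (lam : OneForm E X) (S : Set X) : Prop where
  isCompact : IsCompact S
  submanifold : IsSubmanifold E (n + 1) S
  tangent : ∀ x ∈ S, ∀ u : TangentSpace 𝓘(ℝ, E) x, TangentTo (n + 1) S x u → lam x u = 0

/-! ### Interlinking -/

/-- The pair `(L₀, L₁)` is interlinked with respect to the contact form `lam`: the two sets are
disjoint and, for some `μ > 0`, every complete bounded contact Hamiltonian `F ≥ a > 0` has an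
orbit of time-length at most `μ / a` from `L₀` to `L₁`. -/
def InterlinkedFor [IsManifold 𝓘(ℝ, E) ∞ X] (lam : OneForm E X) (L₀ L₁ : Set X) : Prop :=
  Disjoint L₀ L₁ ∧ ∃ μ : ℝ, 0 < μ ∧
    ∀ (F : X → ℝ) (v : VField E X) (a : ℝ), SmoothFun E F → IsContactField lam F v →
      CompleteField v → 0 < a → (∀ x, a ≤ F x) → (∃ b : ℝ, ∀ x, F x ≤ b) →
      ∃ (γ : ℝ → X) (T : ℝ), IsMIntegralCurve γ v ∧ 0 ≤ T ∧ T ≤ μ / a ∧ γ 0 ∈ L₀ ∧ γ T ∈ L₁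

/-- The diffeomorphism `g` is `ε`-close to the identity on `C`, together with its derivatives up
to order `k`, in the chart centred at `c`. -/
def CloseToId (k : ℕ) (ε : ℝ) (c : X) (C : Set X)
    (g : X ≃ₘ^∞⟮𝓘(ℝ, E), 𝓘(ℝ, E)⟯ X) : Prop :=
  ∀ x ∈ C, g x ∈ (extChartAt 𝓘(ℝ, E) c).source ∧ ∀ j ≤ k,
    ‖iteratedFDeriv ℝ j
      (fun y : E => extChartAt 𝓘(ℝ, E) c (g ((extChartAt 𝓘(ℝ, E) c).symm y)) - y)
      (extChartAt 𝓘(ℝ, E) c x)‖ < ε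

/-- `𝒰` is a neighbourhood of the compact submanifold `S` in the `C^∞` topology: it contains all
the images `g(S)` of `S` by the diffeomorphisms `g` in some neighbourhood of the identity for the
(weak) `C^∞` topology, given by finitely many compact sets in charts, an order and a size. -/
def IsSmoothNhd (E : Type*) [NormedAddCommGroup E] [NormedSpace ℝ E]
    {X : Type*} [TopologicalSpace X] [ChartedSpace E X]
    (S : Set X) (𝒰 : Set (Set X)) : Prop :=
  ∃ (m k : ℕ) (ε : ℝ) (c : Fin m → X) (C : Fin m → Set X), 0 < ε ∧
    (∀ i, IsCompact (C i) ∧ C i ⊆ (extChartAt 𝓘(ℝ, E) (c i)).source) ∧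
    ∀ g : X ≃ₘ^∞⟮𝓘(ℝ, E), 𝓘(ℝ, E)⟯ X, (∀ i, CloseToId k ε (c i) (C i) g) → g '' S ∈ 𝒰

/-- The pair `(L₀, L₁)` is robustly interlinked with respect to `lam`: it is interlinked, and so
is each pair of Legendrian submanifolds that are `C^∞`-close to `L₀` and to `L₁`. -/
def RobustlyInterlinkedFor [IsManifold 𝓘(ℝ, E) ∞ X] (n : ℕ) (lam : OneForm E X)
    (L₀ L₁ : Set X) : Prop :=
  InterlinkedFor lam L₀ L₁ ∧ ∃ 𝒰₀ 𝒰₁ : Set (Set X), IsSmoothNhd E L₀ 𝒰₀ ∧ IsSmoothNhd E L₁ 𝒰₁ ∧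
    ∀ L₀' ∈ 𝒰₀, ∀ L₁' ∈ 𝒰₁, IsLegendrian n lam L₀' → IsLegendrian n lam L₁' →
      InterlinkedFor lam L₀' L₁'

/-- Robust interlinking in the manifold `X` with the cooriented contact structure `ker lam`. The
notion is one of the contact structure, only the constants depend on the contact form: the pair is
robustly interlinked with respect to each contact form `g lam`, `g > 0`, of this cooriented
structure whose Reeb flow is complete. -/
def RobustlyInterlinked [IsManifold 𝓘(ℝ, E) ∞ X] (n : ℕ) (lam : OneForm E X)
    (L₀ L₁ : Set X) : Prop :=
  ∀ (g : X → ℝ) (R : VField E X), SmoothFun E g → (∀ x, 0 < g x) →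
    IsReeb (OneForm.rescale g lam) R → CompleteField R →
    RobustlyInterlinkedFor n (OneForm.rescale g lam) L₀ L₁

/-! ### The nodal domain, its boundary and the cores -/

/-- `W` is a connected component of `{H > 0}`. -/
def IsPositiveDomain (H : X → ℝ) (W : Set X) : Prop :=
  ∃ x, 0 < H x ∧ W = connectedComponentIn {y | 0 < H y} x

/-- `M₋ = {x ∈ M : d_x H(R) < 0}`. -/
def negPart (H : X → ℝ) (R : VField E X) (M : Set X) : Set X := {x ∈ M | dFun H x (R x) < 0}

/-- `M₊ = {x ∈ M : d_x H(R) > 0}`. -/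
def posPart (H : X → ℝ) (R : VField E X) (M : Set X) : Set X := {x ∈ M | 0 < dFun H x (R x)}

/-- The separating hypersurface `Γ = {x ∈ M : d_x H(R) = 0}`. -/
def separating (H : X → ℝ) (R : VField E X) (M : Set X) : Set X := {x ∈ M | dFun H x (R x) = 0}

/-- For a smooth hypersurface `M` that is invariant under the flow `φ` of `v`: `Γ` is a smooth
hypersurface of `M` (so it has codimension two in the ambient manifold) that separates `M₊` from
`M₋`, and at each of its points `v` is transversal to `Γ` and points into `M₋`, so that the
trajectories cross `Γ` from `M₊` to `M₋`. -/
structure CrossesIntoNeg (H : X → ℝ) (R v : VField E X) (φ : ℝ → X → X) (M : Set X) : Prop where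
  submanifold : IsSubmanifold E 2 (separating H R M)
  transversal : ∀ x ∈ separating H R M, ¬ TangentTo 2 (separating H R M) x (v x)
  after : ∀ x ∈ separating H R M, ∀ᶠ t in 𝓝[>] (0 : ℝ), φ t x ∈ negPart H R M
  before : ∀ x ∈ separating H R M, ∀ᶠ t in 𝓝[<] (0 : ℝ), φ t x ∈ posPart H R M

/-- The core `Q₋` of `M₋`: the intersection of the sets `φ^s(M₋)`, `s > 0`. -/
def negCore (H : X → ℝ) (R : VField E X) (φ : ℝ → X → X) (M : Set X) : Set X :=
  ⋂ s : ℝ, ⋂ _ : 0 < s, φ s '' negPart H R M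

end ContactDyn

end

open Set Filter Topology
open scoped Manifold ContDiff

noncomputable section

namespace ContactDyn

variable {E : Type*} [NormedAddCommGroup E] [NormedSpace ℝ E]
  {X : Type*} [TopologicalSpace X] [ChartedSpace E X]

section

/-! ### Integral curves -/

/-! Write ρ = dH(R) and M = ∂W. Evaluating the contact condition on R and on v gives dH(v) = Hρ
(`dFun_contactField`): along trajectories H grows or decays at exponential rate ρ, so W and M are
invariant under the flow. In positive time the compact set M₋ ∪ Γ is mapped into M₋, near which H
contracts. Hence M₋ ∪ Γ has a neighbourhood O such that every trajectory through O ∩ W converges to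
the core (`exists_isOpen_tendsto_negCore`), and it suffices to find a trajectory from K that enters
O.

For this, H is replaced by a positive Hamiltonian F, equal to H on W outside a compact collar Z of M
on which H ≤ δ, and constant outside W (`exists_truncated_contactField`). Its contact field u is
complete (`completeField_of_eq_flow`) and is the Reeb field of `lam / F`
(`IsContactField.isReeb_rescale_inv`). Interlinking for this contact form gives an orbit of u from K
to Λ ⊂ M. The trajectory of v from the same point never reaches M, so the two must separate, which
requires a visit to Z. At the first entry into Z, H comes down to δ from above, so Hρ ≤ 0 and ρ ≤ 0.
As Z is chosen inside O ∪ {ρ > 0}, the entry point lies in O (`exists_tendsto_negCore`). -/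

/-- A `C¹` vector field has integral curves on a common time interval, starting from all the points
of some neighbourhood of a given point. -/
theorem exists_uniform_time_nhds [CompleteSpace E] [IsManifold 𝓘(ℝ, E) 1 X] {u : VField E X}
    (hu : ContMDiff 𝓘(ℝ, E) 𝓘(ℝ, E).tangent 1 (fun x => (⟨x, u x⟩ : TangentBundle 𝓘(ℝ, E) X)))
    (x₀ : X) :
    ∃ ε > (0 : ℝ), ∀ᶠ x in 𝓝 x₀, ∃ γ : ℝ → X, γ 0 = x ∧ IsMIntegralCurveOn γ u (Ioo (-ε) ε) := by
  have hv := hu.contMDiffAt (x := x₀)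
  rw [contMDiffAt_iff] at hv
  obtain ⟨_, hv⟩ := hv
  have hx : (𝓘(ℝ, E)).IsInteriorPoint x₀ := BoundarylessManifold.isInteriorPoint
  have hv2 := (hv.contDiffAt (range_mem_nhds_isInteriorPoint hx)).snd
  obtain ⟨ε, hε, a, r, _, _, hr, hpl⟩ := IsPicardLindelof.of_contDiffAt_one hv2
  obtain ⟨α, hα, hαc⟩ := (hpl 0).exists_forall_mem_closedBall_eq_hasDerivWithinAt_continuousOn
  set y₀ := extChartAt 𝓘(ℝ, E) x₀ x₀ with hy₀
  have hy₀T : y₀ ∈ (extChartAt 𝓘(ℝ, E) x₀).target := mem_extChartAt_target x₀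
  have hT : IsOpen (extChartAt 𝓘(ℝ, E) x₀).target := isOpen_extChartAt_target x₀
  have hcont : ContinuousAt α (y₀, 0) := hαc.continuousAt
    (prod_mem_nhds (Metric.closedBall_mem_nhds _ hr) (Icc_mem_nhds (by linarith) (by linarith)))
  have hα0 : α (y₀, 0) = y₀ := (hα y₀ (Metric.mem_closedBall_self hr.le)).1
  have hev : ∀ᶠ p : E × ℝ in 𝓝 (y₀, 0), α p ∈ (extChartAt 𝓘(ℝ, E) x₀).target :=
    hcont.eventually (by rw [hα0]; exact hT.mem_nhds hy₀T)
  -- For starting points near `y₀` and small times, the local flow stays in the chart target, so it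
  -- can be pulled back to `X`.
  rw [nhds_prod_eq] at hev
  obtain ⟨p, hp, q, hq, hpq⟩ := eventually_prod_iff.1 hev
  obtain ⟨δ, hδ, hq⟩ := Metric.eventually_nhds_iff.1 hq
  refine ⟨min δ ε, lt_min hδ hε, ?_⟩
  have h1 : ∀ᶠ x in 𝓝 x₀, p (extChartAt 𝓘(ℝ, E) x₀ x) :=
    (continuousAt_extChartAt x₀).eventually hp
  have h2 : ∀ᶠ x in 𝓝 x₀, extChartAt 𝓘(ℝ, E) x₀ x ∈ Metric.closedBall y₀ r :=
    (continuousAt_extChartAt x₀).eventually (Metric.closedBall_mem_nhds _ hr)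
  have h3 : ∀ᶠ x in 𝓝 x₀, x ∈ (extChartAt 𝓘(ℝ, E) x₀).source := extChartAt_source_mem_nhds x₀
  filter_upwards [h1, h2, h3] with x hx1 hx2 hx3
  set f : ℝ → E := fun t => α (extChartAt 𝓘(ℝ, E) x₀ x, t) with hf
  obtain ⟨hf0, hfd⟩ := hα _ hx2
  refine ⟨(extChartAt 𝓘(ℝ, E) x₀).symm ∘ f, ?_, ?_⟩
  · simp only [Function.comp_apply, hf]
    rw [hf0, (extChartAt 𝓘(ℝ, E) x₀).left_inv hx3]
  intro t ht
  have ht1 : |t| < min δ ε := abs_lt.2 ht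
  have hf3 : f t ∈ (extChartAt 𝓘(ℝ, E) x₀).target :=
    hpq hx1 (hq (by rw [Real.dist_eq, sub_zero]; exact ht1.trans_le (min_le_left _ _)))
  have ht2 := abs_lt.1 (ht1.trans_le (min_le_right _ _))
  have hd := (hfd t ⟨by linarith [ht2.1], by linarith [ht2.2]⟩).hasDerivAt
    (Icc_mem_nhds (by linarith [ht2.1]) (by linarith [ht2.2]))
  let xₜ : X := (extChartAt 𝓘(ℝ, E) x₀).symm (f t)
  have h : HasDerivAt f (x := t) <| fderivWithin ℝ
    (extChartAt 𝓘(ℝ, E) x₀ ∘ (extChartAt 𝓘(ℝ, E) xₜ).symm)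
    (range 𝓘(ℝ, E)) (extChartAt 𝓘(ℝ, E) xₜ xₜ) (u xₜ) := hd
  rw [← tangentCoordChange_def] at h
  have hft1 := mem_preimage.mp <|
    mem_of_mem_of_subset hf3 (extChartAt 𝓘(ℝ, E) x₀).target_subset_preimage_source
  have hft2 := mem_extChartAt_source (I := 𝓘(ℝ, E)) xₜ
  apply HasMFDerivAt.hasMFDerivWithinAt
  have key : ∀ (f : ℝ → E) (w : E), HasDerivAt f w t →
      HasFDerivWithinAt f ((1 : ℝ →L[ℝ] ℝ).smulRight w) (range 𝓘(ℝ, ℝ)) t := fun f w hw => by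
    rw [ContinuousLinearMap.smulRight_one_eq_toSpanSingleton]
    exact hw.hasFDerivAt.hasFDerivWithinAt
  -- Picard–Lindelöf gives the velocity in the fixed chart at `x₀`; a manifold derivative is read in
  -- the chart at the moving point `xₜ`. The two coordinate changes cancel.
  have hchange : ∀ w : E, HasDerivAt f (tangentCoordChange 𝓘(ℝ, E) xₜ x₀ xₜ w) t →
      HasDerivAt ((extChartAt 𝓘(ℝ, E) xₜ ∘ (extChartAt 𝓘(ℝ, E) x₀).symm) ∘ f) w t := by
    intro w hw
    have hc : HasFDerivAt (extChartAt 𝓘(ℝ, E) xₜ ∘ (extChartAt 𝓘(ℝ, E) x₀).symm)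
        (tangentCoordChange 𝓘(ℝ, E) x₀ xₜ xₜ) (f t) := by
      apply HasFDerivWithinAt.hasFDerivAt (s := range 𝓘(ℝ, E)) _ (by simp)
      rw [← (extChartAt 𝓘(ℝ, E) x₀).right_inv hf3]
      exact hasFDerivWithinAt_tangentCoordChange ⟨hft1, hft2⟩
    refine (hc.comp_hasDerivAt t hw).congr_deriv ?_
    rw [tangentCoordChange_comp ⟨⟨hft2, hft1⟩, hft2⟩, tangentCoordChange_self hft2]
  exact ⟨(continuousAt_extChartAt_symm'' hf3).comp h.continuousAt, key _ _ (hchange (u xₜ) h)⟩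

theorem exists_uniform_time_of_isCompact [CompleteSpace E] [IsManifold 𝓘(ℝ, E) 1 X] {u : VField E X}
    (hu : ContMDiff 𝓘(ℝ, E) 𝓘(ℝ, E).tangent 1 (fun x => (⟨x, u x⟩ : TangentBundle 𝓘(ℝ, E) X)))
    {Z : Set X} (hZ : IsCompact Z) :
    ∃ ε > (0 : ℝ), ∀ x ∈ Z, ∃ γ : ℝ → X, γ 0 = x ∧ IsMIntegralCurveOn γ u (Ioo (-ε) ε) := by
  refine hZ.induction_on (p := fun S => ∃ ε > (0 : ℝ), ∀ x ∈ S, ∃ γ : ℝ → X, γ 0 = x ∧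
    IsMIntegralCurveOn γ u (Ioo (-ε) ε)) ⟨1, one_pos, by simp⟩ ?_ ?_ ?_
  · rintro s t hst ⟨ε, hε, h⟩
    exact ⟨ε, hε, fun x hx => h x (hst hx)⟩
  · rintro s t ⟨ε, hε, h⟩ ⟨δ, hδ, h'⟩
    refine ⟨min ε δ, lt_min hε hδ, ?_⟩
    rintro x (hx | hx)
    · obtain ⟨γ, h0, hγ⟩ := h x hx
      exact ⟨γ, h0, hγ.mono (Ioo_subset_Ioo (neg_le_neg (min_le_left _ _)) (min_le_left _ _))⟩
    · obtain ⟨γ, h0, hγ⟩ := h' x hx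
      exact ⟨γ, h0, hγ.mono (Ioo_subset_Ioo (neg_le_neg (min_le_right _ _)) (min_le_right _ _))⟩
  · intro x _
    obtain ⟨ε, hε, h⟩ := exists_uniform_time_nhds hu x
    exact ⟨_, mem_nhdsWithin_of_mem_nhds h, ε, hε, fun y hy => hy⟩

theorem exists_Ioo_of_Icc_subset {p q : ℝ} (hpq : p ≤ q) {U : Set ℝ} (hU : IsOpen U)
    (h : Icc p q ⊆ U) : ∃ a b, a < p ∧ q < b ∧ Ioo a b ⊆ U := by
  obtain ⟨η, hη, hsub⟩ := isCompact_Icc.exists_thickening_subset_open hU h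
  refine ⟨p - η, q + η, by linarith, by linarith, fun t ht => hsub ?_⟩
  rw [Metric.mem_thickening_iff]
  rcases lt_or_ge t p with h1 | h1
  · exact ⟨p, ⟨le_rfl, hpq⟩, by rw [Real.dist_eq, abs_lt]; constructor <;> linarith [ht.1]⟩
  rcases lt_or_ge q t with h2 | h2
  · exact ⟨q, ⟨hpq, le_rfl⟩, by rw [Real.dist_eq, abs_lt]; constructor <;> linarith [ht.2]⟩
  · exact ⟨t, ⟨h1, h2⟩, by simpa using hη⟩

/-- A `C¹` vector field is complete if, away from a compact set `Z`, its integral curves are defined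
as long as they do not meet `Z`. -/
theorem completeField_of_isCompact [CompleteSpace E] [IsManifold 𝓘(ℝ, E) 1 X] [T2Space X]
    [LocallyCompactSpace X] {u : VField E X}
    (hu : ContMDiff 𝓘(ℝ, E) 𝓘(ℝ, E).tangent 1 (fun x => (⟨x, u x⟩ : TangentBundle 𝓘(ℝ, E) X)))
    {Z : Set X} (hZ : IsCompact Z)
    (h : ∀ x ∉ Z, ∃ γ : ℝ → X, γ 0 = x ∧ Continuous γ ∧ ∀ t : ℝ, (∀ s ∈ uIcc 0 t, γ s ∉ Z) →
      HasMFDerivAt 𝓘(ℝ, ℝ) 𝓘(ℝ, E) γ t ((1 : ℝ →L[ℝ] ℝ).smulRight (u (γ t)))) :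
    CompleteField u := by
  -- A curve coming from outside must enter the compact neighbourhood `Z₁` before it meets `Z`; at
  -- that moment it is still an integral curve, and the existence time `ε₀` is available.
  obtain ⟨Z₁, hZ₁, hZZ₁⟩ := exists_compact_superset hZ
  obtain ⟨ε₀, hε₀, hloc⟩ := exists_uniform_time_of_isCompact hu hZ₁
  -- A uniform existence time implies completeness. Half of `ε₀` is kept in reserve for the time
  -- spent before entering `Z₁`.
  have hε : 0 < ε₀ / 2 := by positivity
  refine fun x => exists_isMIntegralCurve_of_isMIntegralCurveOn hu hε ?_ x
  intro x
  by_cases hx : x ∈ Z₁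
  · obtain ⟨γ, h0, hγ⟩ := hloc x hx
    exact ⟨γ, h0, hγ.mono (Ioo_subset_Ioo (by linarith) (by linarith))⟩
  obtain ⟨γ, h0, hγc, hγ⟩ := h x (fun hxZ => hx (interior_subset (hZZ₁ hxZ)))
  by_cases hall : ∀ t ∈ Ioo (-(ε₀ / 2)) (ε₀ / 2), γ t ∉ Z
  · refine ⟨γ, h0, fun t ht => (hγ t fun s hs => hall s ?_).hasMFDerivWithinAt⟩
    exact (ordConnected_Ioo.uIcc_subset ⟨by linarith, by linarith⟩ ht) hs
  push Not at hall
  obtain ⟨t₂, ht₂, hγt₂⟩ := hall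
  have hS : IsCompact (Icc (-|t₂|) |t₂| ∩ γ ⁻¹' Z₁) :=
    isCompact_Icc.inter_right (hZ₁.isClosed.preimage hγc)
  -- Minimising |t| treats forward and backward time together.
  obtain ⟨t₁, ⟨ht₁, hγt₁⟩, hmin⟩ := hS.exists_isMinOn
    ⟨t₂, abs_le.1 le_rfl, (interior_subset (hZZ₁ hγt₂) : γ t₂ ∈ Z₁)⟩ continuous_abs.continuousOn
  have ht₁' : |t₁| ≤ |t₂| := abs_le.2 ht₁
  have hbefore : ∀ s, |s| < |t₁| → γ s ∉ Z₁ := by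
    intro s hs hsZ
    have := isMinOn_iff.1 hmin s ⟨abs_le.1 (hs.le.trans ht₁'), hsZ⟩
    linarith
  have ht₁0 : t₁ ≠ 0 := by
    rintro rfl
    exact hx (h0 ▸ hγt₁)
  have ht₁Z : γ t₁ ∉ Z := by
    intro hz
    have hev : ∀ᶠ c : ℝ in 𝓝[<] 1, γ (c * t₁) ∈ interior Z₁ := by
      have hc : Tendsto (fun c : ℝ => γ (c * t₁)) (𝓝[<] 1) (𝓝 (γ t₁)) := by
        have : Continuous (fun c : ℝ => γ (c * t₁)) := hγc.comp (continuous_id.mul continuous_const)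
        simpa using (this.tendsto 1).mono_left nhdsWithin_le_nhds
      exact hc.eventually (isOpen_interior.mem_nhds (hZZ₁ hz))
    have h01 : ∀ᶠ c : ℝ in 𝓝[<] 1, c ∈ Ioo (0 : ℝ) 1 := Ioo_mem_nhdsLT one_pos
    obtain ⟨c, hc1, hc2⟩ := (hev.and h01).exists
    refine hbefore (c * t₁) ?_ (interior_subset hc1)
    rw [abs_mul, abs_of_pos hc2.1]
    exact mul_lt_of_lt_one_left (abs_pos.2 ht₁0) hc2.2
  have hu0 : ∀ s ∈ uIcc 0 t₁, γ s ∉ Z := by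
    intro s hs
    have hs' : |s| ≤ |t₁| := by simpa using abs_sub_left_of_mem_uIcc hs
    rcases hs'.lt_or_eq with hlt | heq
    · exact fun hz => hbefore s hlt (interior_subset (hZZ₁ hz))
    · have : s = t₁ := by
        rcases le_total 0 t₁ with h1 | h1
        · rw [uIcc_of_le h1] at hs
          rwa [abs_of_nonneg h1, abs_of_nonneg hs.1] at heq
        · rw [uIcc_of_ge h1] at hs
          rw [abs_of_nonpos h1, abs_of_nonpos hs.2] at heq
          linarith
      rwa [this]
  obtain ⟨σ, hσ0, hσ⟩ := hloc (γ t₁) hγt₁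
  have ht₁ε : |t₁| < ε₀ / 2 := ht₁'.trans_lt (abs_lt.2 ht₂)
  have hσ' := hσ.comp_add (-t₁)
  have hU : IsOpen (γ ⁻¹' Zᶜ ∩ {t | t + -t₁ ∈ Ioo (-ε₀) ε₀}) :=
    (hZ.isClosed.isOpen_compl.preimage hγc).inter
      (isOpen_Ioo.preimage (continuous_id.add continuous_const))
  obtain ⟨a, b, ha, hb, hab⟩ := exists_Ioo_of_Icc_subset (p := min 0 t₁) (q := max 0 t₁)
    (min_le_max) hU (by
      intro s hs
      refine ⟨hu0 s hs, ?_⟩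
      have := abs_sub_right_of_mem_uIcc hs
      have h3 : |s - t₁| < ε₀ := by
        rw [abs_sub_comm]
        have : |t₁ - s| ≤ |t₁| := by simpa using this
        linarith
      exact ⟨by linarith [(abs_lt.1 h3).1], by linarith [(abs_lt.1 h3).2]⟩)
  have m0 : (0 : ℝ) ∈ Ioo a b := ⟨ha.trans_le (min_le_left _ _), (le_max_left _ _).trans_lt hb⟩
  have m1 : t₁ ∈ Ioo a b := ⟨ha.trans_le (min_le_right _ _), (le_max_right _ _).trans_lt hb⟩
  have hγu : IsMIntegralCurveOn γ u (Ioo a b) := fun t ht =>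
    (hγ t fun s hs => (hab (ordConnected_Ioo.uIcc_subset m0 ht hs)).1).hasMFDerivWithinAt
  -- By uniqueness the local curve through `γ t₁`, shifted by `t₁`, passes through `x` at time 0;
  -- the shift costs less than `ε₀ / 2`.
  have heq := isMIntegralCurveOn_Ioo_eqOn_of_contMDiff_boundaryless m1 hu hγu
    (hσ'.mono fun t ht => (hab ht).2) (by simp [hσ0])
  refine ⟨σ ∘ (· + -t₁), by rw [← heq m0, h0], hσ'.mono ?_⟩
  intro t ht
  have := abs_lt.1 ht₁ε
  exact ⟨by linarith [ht.1], by linarith [ht.2]⟩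

theorem subset_of_isPreconnected_of_disjoint_frontier {Y : Type*} [TopologicalSpace Y] {s W : Set Y}
    (hs : IsPreconnected s) (hW : IsOpen W) (hne : (s ∩ W).Nonempty)
    (hd : Disjoint s (frontier W)) : s ⊆ W := by
  refine hs.subset_left_of_subset_union hW isClosed_closure.isOpen_compl
    (disjoint_compl_right.mono_left subset_closure) (fun x hx => ?_) hne
  by_cases hxW : x ∈ W
  · exact Or.inl hxW
  · refine Or.inr fun hc => disjoint_left.1 hd hx ?_
    rw [hW.frontier_eq]
    exact ⟨hc, hxW⟩

end

section

/-! ### Differentials of functions -/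

theorem exists_hasFDerivAt_comp_extChartAt_symm {g : X → ℝ} {x : X}
    (hg : MDifferentiableAt 𝓘(ℝ, E) 𝓘(ℝ, ℝ) g x) :
    ∃ L : E →L[ℝ] ℝ, (∀ w : E, L w = dFun g x w) ∧
      HasFDerivAt (fun y : E => g ((extChartAt 𝓘(ℝ, E) x).symm y)) L (extChartAt 𝓘(ℝ, E) x x) :=
  ⟨mfderiv 𝓘(ℝ, E) 𝓘(ℝ, ℝ) g x, fun _ => rfl,
    HasFDerivWithinAt.hasFDerivAt (s := range 𝓘(ℝ, E)) hg.hasMFDerivAt.2 (by simp)⟩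

theorem dFun_congr {F G : X → ℝ} {x : X} (h : F =ᶠ[𝓝 x] G) (w : TangentSpace 𝓘(ℝ, E) x) :
    dFun F x w = dFun G x w := by
  simp only [dFun]
  rw [h.mfderiv_eq]
  rfl

theorem hasFDerivAt_comp_apply {f : ℝ → ℝ} {f' : ℝ} {g : E → ℝ} {g' : E →L[ℝ] ℝ} {y : E}
    (hf : HasDerivAt f f' (g y)) (hg : HasFDerivAt g g' y) :
    HasFDerivAt (fun z => f (g z)) (f' • g') y := hf.comp_hasFDerivAt y hg

theorem dFun_comp {H : X → ℝ} {f : ℝ → ℝ} {x : X} {f' : ℝ} (hf : HasDerivAt f f' (H x))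
    (hH : MDifferentiableAt 𝓘(ℝ, E) 𝓘(ℝ, ℝ) H x) (w : TangentSpace 𝓘(ℝ, E) x) :
    dFun (fun y => f (H y)) x w = f' * dFun H x w := by
  have hc : MDifferentiableAt 𝓘(ℝ, E) 𝓘(ℝ, ℝ) (fun y => f (H y)) x :=
    (mdifferentiableAt_iff_differentiableAt.2 hf.differentiableAt).comp x hH
  obtain ⟨L, hL, h1⟩ := exists_hasFDerivAt_comp_extChartAt_symm hc
  obtain ⟨L', hL', h2⟩ := exists_hasFDerivAt_comp_extChartAt_symm hH
  have h3 := hasFDerivAt_comp_apply (f := f) (f' := f') (by rwa [extChartAt_to_inv]) h2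
  rw [← hL w, ← hL' w, h1.unique h3]
  rfl

theorem dFun_const (c : ℝ) (x : X) (w : TangentSpace 𝓘(ℝ, E) x) :
    dFun (fun _ : X => c) x w = 0 := by
  simp only [dFun]
  rw [mfderiv_const]
  rfl

theorem SmoothFun.mdifferentiableAt {H : X → ℝ} (hH : SmoothFun E H) (x : X) :
    MDifferentiableAt 𝓘(ℝ, E) 𝓘(ℝ, ℝ) H x :=
  ContMDiffAt.mdifferentiableAt (ContMDiff.contMDiffAt hH) (by simp)

theorem SmoothFun.continuous {H : X → ℝ} (hH : SmoothFun E H) : Continuous H :=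
  ContMDiff.continuous hH

theorem SmoothFun.inv {F : X → ℝ} (hF : SmoothFun E F) (hpos : ∀ x, 0 < F x) :
    SmoothFun E fun x => (F x)⁻¹ := fun x =>
  ((contDiffAt_inv ℝ (hpos x).ne').contMDiffAt).comp x (hF x)

theorem continuous_dFun [IsManifold 𝓘(ℝ, E) ∞ X] {H : X → ℝ} (hH : SmoothFun E H)
    {R : VField E X} (hR : SmoothField R) : Continuous fun x => dFun H x (R x) := by
  have h1 : Continuous (tangentMap 𝓘(ℝ, E) 𝓘(ℝ, ℝ) H) :=
    ContMDiff.continuous_tangentMap hH (by simp)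
  have h2 := h1.comp hR.continuous
  exact (contMDiff_snd_tangentBundle_modelSpace ℝ 𝓘(ℝ, ℝ) (n := 1)).continuous.comp h2

theorem hasDerivAt_comp_curve {H : X → ℝ} {γ : ℝ → X} {v : VField E X} {t : ℝ}
    (hH : MDifferentiableAt 𝓘(ℝ, E) 𝓘(ℝ, ℝ) H (γ t))
    (hγ : HasMFDerivAt 𝓘(ℝ, ℝ) 𝓘(ℝ, E) γ t ((1 : ℝ →L[ℝ] ℝ).smulRight (v (γ t)))) :
    HasDerivAt (fun s => H (γ s)) (dFun H (γ t) (v (γ t))) t := by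
  have key : ∀ (A : E →L[ℝ] ℝ) (w : E),
      HasMFDerivAt 𝓘(ℝ, ℝ) 𝓘(ℝ, ℝ) (H ∘ γ) t (A.comp ((1 : ℝ →L[ℝ] ℝ).smulRight w)) →
      HasDerivAt (H ∘ γ) (A w) t := by
    intro A w h
    have h' : HasFDerivAt (H ∘ γ) (A.comp ((1 : ℝ →L[ℝ] ℝ).smulRight w)) t :=
      hasMFDerivAt_iff_hasFDerivAt.1 h
    simpa using h'.hasDerivAt
  exact key _ _ (hH.hasMFDerivAt.comp t hγ)

/-! ### The exterior derivative -/

theorem mfderiv_extChartAt_symm_self [IsManifold 𝓘(ℝ, E) 1 X] (x : X) (w : E) :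
    mfderiv 𝓘(ℝ, E) 𝓘(ℝ, E) (extChartAt 𝓘(ℝ, E) x).symm (extChartAt 𝓘(ℝ, E) x x) w = w := by
  have hx := mem_extChartAt_source (I := 𝓘(ℝ, E)) x
  -- The base point of the derivative is `x` only up to a propositional equality, hence the
  -- generalisation to `z`.
  have hd : ∀ z : X, z = x → HasFDerivWithinAt (extChartAt 𝓘(ℝ, E) z ∘ (extChartAt 𝓘(ℝ, E) x).symm)
      (ContinuousLinearMap.id ℝ E) (range 𝓘(ℝ, E)) (extChartAt 𝓘(ℝ, E) x x) := by
    rintro z rfl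
    refine (hasFDerivWithinAt_tangentCoordChange ⟨hx, hx⟩).congr_fderiv ?_
    ext v
    exact tangentCoordChange_self hx
  have h : HasMFDerivAt 𝓘(ℝ, E) 𝓘(ℝ, E) (extChartAt 𝓘(ℝ, E) x).symm (extChartAt 𝓘(ℝ, E) x x)
      (ContinuousLinearMap.id ℝ E) :=
    ⟨continuousAt_extChartAt_symm x, hd _ (extChartAt_to_inv x)⟩
  exact congrArg (fun L : E →L[ℝ] E => L w) h.mfderiv

theorem OneForm.inChart_self [IsManifold 𝓘(ℝ, E) 1 X] (lam : OneForm E X) (x : X) (w : E) :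
    lam.inChart x (extChartAt 𝓘(ℝ, E) x x) w = lam x w := by
  have h2 : ∀ z, z = x → ∀ w' : E, w' = w → (lam z : E →L[ℝ] ℝ) w' = lam x w := by
    rintro z rfl w' rfl; rfl
  exact h2 _ (extChartAt_to_inv x) _ (mfderiv_extChartAt_symm_self x w)

theorem OneForm.d_self (lam : OneForm E X) (x : X) (u : TangentSpace 𝓘(ℝ, E) x) :
    lam.d x u u = 0 := sub_self _

theorem OneForm.d_swap (lam : OneForm E X) (x : X) (u w : TangentSpace 𝓘(ℝ, E) x) :
    lam.d x u w = -lam.d x w u := (neg_sub _ _).symm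

theorem OneForm.d_add_left (lam : OneForm E X) (x : X) (u u' w : TangentSpace 𝓘(ℝ, E) x) :
    lam.d x (u + u') w = lam.d x u w + lam.d x u' w := by
  have key : ∀ (D : E →L[ℝ] (E →L[ℝ] ℝ)) (u u' w : E),
      D (u + u') w - D w (u + u') = (D u w - D w u) + (D u' w - D w u') := by
    intro D u u' w
    simp only [map_add, add_apply]
    ring
  exact key _ u u' w

theorem OneForm.d_smul_left (lam : OneForm E X) (x : X) (a : ℝ) (u w : TangentSpace 𝓘(ℝ, E) x) :
    lam.d x (a • u) w = a * lam.d x u w := by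
  have key : ∀ (D : E →L[ℝ] (E →L[ℝ] ℝ)) (u w : E),
      D (a • u) w - D w (a • u) = a * (D u w - D w u) := by
    intro D u w
    simp only [map_smul, smul_apply, smul_eq_mul]
    ring
  exact key _ u w

/-- The Leibniz rule `d(g lam) = dg ∧ lam + g d lam`. -/
theorem OneForm.d_rescale [IsManifold 𝓘(ℝ, E) 1 X] {lam : OneForm E X} (hlam : lam.Smooth)
    {g : X → ℝ} {x : X}
    (hg : MDifferentiableAt 𝓘(ℝ, E) 𝓘(ℝ, ℝ) g x) (u w : TangentSpace 𝓘(ℝ, E) x) :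
    (OneForm.rescale g lam).d x u w =
      dFun g x u * lam x w - dFun g x w * lam x u + g x * lam.d x u w := by
  have key : ∀ (g : E → ℝ) (g' : E →L[ℝ] ℝ) (f : E → E →L[ℝ] ℝ) (y u w : E), HasFDerivAt g g' y →
      DifferentiableAt ℝ f y →
      fderiv ℝ (fun z => g z • f z) y u w - fderiv ℝ (fun z => g z • f z) y w u =
        g' u * f y w - g' w * f y u + g y * (fderiv ℝ f y u w - fderiv ℝ f y w u) := by
    intro g g' f y u w h1 h2
    have h3 : HasFDerivAt (fun z => g z • f z) _ y := h1.smul h2.hasFDerivAt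
    rw [h3.fderiv]
    simp
    ring
  have h2 : DifferentiableAt ℝ (OneForm.inChart lam x) (extChartAt 𝓘(ℝ, E) x x) :=
    ((hlam x).contDiffAt ((isOpen_extChartAt_target x).mem_nhds
      (mem_extChartAt_target x))).differentiableAt (by simp)
  obtain ⟨L, hL, h1⟩ := exists_hasFDerivAt_comp_extChartAt_symm hg
  have h4 := key _ _ _ _ u w h1 h2
  have e3 : g ((extChartAt 𝓘(ℝ, E) x).symm (extChartAt 𝓘(ℝ, E) x x)) = g x := by
    rw [extChartAt_to_inv]
  rw [lam.inChart_self x u, lam.inChart_self x w, e3] at h4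
  rw [← hL u, ← hL w]
  exact h4

/-! ### Contact fields -/

/-- In the relation d lam(v, ·) + dH = c lam, evaluation at R gives c = dH(R), and evaluation at v
gives dH(v) = cH. -/
theorem dFun_contactField [IsManifold 𝓘(ℝ, E) ∞ X] {lam : OneForm E X} {R v : VField E X}
    {H : X → ℝ} (hR : IsReeb lam R) (hv : IsContactField lam H v) (x : X) :
    dFun H x (v x) = H x * dFun H x (R x) := by
  obtain ⟨c, hc⟩ := hv.preserves x
  have h1 := hc (R x)
  have h2 := hc (v x)
  rw [lam.d_swap, hR.kernel, hR.normalized] at h1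
  rw [lam.d_self, hv.hamiltonian] at h2
  have : c = dFun H x (R x) := by linarith
  rw [← this]
  linarith

/-- A contact field of a positive Hamiltonian `F` is the Reeb field of `lam / F`. -/
theorem IsContactField.isReeb_rescale_inv [IsManifold 𝓘(ℝ, E) ∞ X] {lam : OneForm E X}
    (hlam : lam.Smooth) {F : X → ℝ} {u : VField E X} (hF : SmoothFun E F) (hpos : ∀ x, 0 < F x)
    (hu : IsContactField lam F u) : IsReeb (OneForm.rescale (fun x => (F x)⁻¹) lam) u := by
  refine ⟨hu.smooth, fun x => ?_, fun x w => ?_⟩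
  · change (F x)⁻¹ * lam x (u x) = 1
    rw [hu.hamiltonian, inv_mul_cancel₀ (hpos x).ne']
  · have hinv : HasDerivAt (fun s : ℝ => s⁻¹) (-(F x ^ 2)⁻¹) (F x) := hasDerivAt_inv (hpos x).ne'
    have hd : MDifferentiableAt 𝓘(ℝ, E) 𝓘(ℝ, ℝ) (fun x => (F x)⁻¹) x :=
      (mdifferentiableAt_iff_differentiableAt.2 hinv.differentiableAt).comp x (hF.mdifferentiableAt x)
    rw [OneForm.d_rescale hlam hd, dFun_comp hinv (hF.mdifferentiableAt x),
      dFun_comp hinv (hF.mdifferentiableAt x), hu.hamiltonian]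
    -- Evaluation at `u` gives dF(u) = cF. With it the terms of the Leibniz expansion cancel in
    -- pairs.
    obtain ⟨c, hc⟩ := hu.preserves x
    have h1 := hc (u x)
    have h2 := hc w
    rw [lam.d_self, hu.hamiltonian] at h1
    have h3 : lam.d x (u x) w = c * lam x w - dFun F x w := by linarith
    have h4 : dFun F x (u x) = c * F x := by linarith
    rw [h3, h4]
    have := (hpos x).ne'
    field_simp
    ring

theorem IsReeb.isContactField_one [IsManifold 𝓘(ℝ, E) ∞ X] {lam : OneForm E X} {R : VField E X}
    (hR : IsReeb lam R) : IsContactField lam (fun _ => 1) R :=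
  ⟨hR.smooth, hR.normalized, fun x => ⟨0, fun w => by rw [hR.kernel, dFun_const]; simp⟩⟩

/-- The contact field of the Hamiltonian `f ∘ H`, in terms of the Reeb field `R` and the contact
field `v` of `H`. -/
def compField (f : ℝ → ℝ) (H : X → ℝ) (R v : VField E X) : VField E X :=
  (fun x => f (H x)) • R + (fun x => deriv f (H x)) • (v - H • R)

theorem compField_apply (f : ℝ → ℝ) (H : X → ℝ) (R v : VField E X) (x : X) :
    compField f H R v x = f (H x) • R x + deriv f (H x) • (v x + (-H x) • R x) := by
  simp [compField, sub_eq_add_neg]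

theorem smoothField_compField [IsManifold 𝓘(ℝ, E) ∞ X] {f : ℝ → ℝ} (hf : ContDiff ℝ ∞ f)
    {H : X → ℝ} (hH : SmoothFun E H) {R v : VField E X} (hR : SmoothField R) (hv : SmoothField v) :
    SmoothField (compField f H R v) := by
  have h1 : ContMDiff 𝓘(ℝ, E) 𝓘(ℝ, ℝ) ∞ (fun x => f (H x)) := hf.contMDiff.comp hH
  have h2 : ContMDiff 𝓘(ℝ, E) 𝓘(ℝ, ℝ) ∞ (fun x => deriv f (H x)) :=
    (ContDiff.contMDiff (contDiff_infty_iff_deriv.1 hf).2).comp hH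
  exact (h1.smul_section hR).add_section (h2.smul_section (hv.sub_section (hH.smul_section hR)))

/-- A field that is locally of the form `compField f H R v` is a contact field. -/
theorem isContactField_of_locally_compField [IsManifold 𝓘(ℝ, E) ∞ X] {lam : OneForm E X}
    {H : X → ℝ} (hH : SmoothFun E H) {R v : VField E X} (hR : IsReeb lam R)
    (hv : IsContactField lam H v) {F : X → ℝ} {u : VField E X}
    (h : ∀ x, ∃ f : ℝ → ℝ, ContDiff ℝ ∞ f ∧
      ∀ᶠ y in 𝓝 x, F y = f (H y) ∧ u y = compField f H R v y) :
    SmoothFun E F ∧ IsContactField lam F u := by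
  refine ⟨fun x => ?_, fun x => ?_, fun x => ?_, fun x => ?_⟩
  · obtain ⟨f, hf, hx⟩ := h x
    have h1 : ContMDiff 𝓘(ℝ, E) 𝓘(ℝ, ℝ) ∞ (fun x => f (H x)) := hf.contMDiff.comp hH
    exact (h1 x).congr_of_eventuallyEq (hx.mono fun y hy => hy.1)
  · obtain ⟨f, hf, hx⟩ := h x
    refine (smoothField_compField hf hH hR.smooth hv.smooth x).congr_of_eventuallyEq
      (hx.mono fun y hy => ?_)
    simp only [hy.2]
  · obtain ⟨f, hf, hx⟩ := h x
    rw [hx.self_of_nhds.1, hx.self_of_nhds.2, compField_apply, map_add, map_smul, map_smul, map_add,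
      map_smul, hR.normalized, hv.hamiltonian]
    simp
  · obtain ⟨f, hf, hx⟩ := h x
    obtain ⟨c, hc⟩ := hv.preserves x
    -- The conformal factor of `f ∘ H` is f'(H) times that of `H`; the terms along `R` vanish
    -- because d lam(R, ·) = 0.
    refine ⟨deriv f (H x) * c, fun w => ?_⟩
    have hfd : HasDerivAt f (deriv f (H x)) (H x) :=
      ((hf.differentiable (by simp)) (H x)).hasDerivAt
    rw [dFun_congr (hx.mono fun y hy => hy.1) w, dFun_comp hfd (hH.mdifferentiableAt x),
      hx.self_of_nhds.2, compField_apply, lam.d_add_left, lam.d_smul_left, lam.d_smul_left,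
      lam.d_add_left, lam.d_smul_left, hR.kernel]
    have := hc w
    linear_combination deriv f (H x) * this

end

section

/-! ### Flows -/

theorem _root_.IsCompact.exists_pos_forall_lt {Y : Type*} [TopologicalSpace Y] {S : Set Y}
    (hS : IsCompact S) {f : Y → ℝ} (hf : Continuous f) (hpos : ∀ x ∈ S, 0 < f x) :
    ∃ δ > 0, ∀ x ∈ S, δ < f x := by
  rcases S.eq_empty_or_nonempty with rfl | hne
  · exact ⟨1, one_pos, by simp⟩
  · obtain ⟨x, hx, hmin⟩ := hS.exists_isMinOn hne hf.continuousOn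
    refine ⟨f x / 2, half_pos (hpos x hx), fun y hy => ?_⟩
    have := isMinOn_iff.1 hmin y hy
    linarith [hpos x hx]

/-- The integrating factor exp(-∫c) makes the product constant. Nothing is divided by `h`, so zeros
of `h` are allowed. -/
theorem eq_mul_exp_of_hasDerivAt {h c : ℝ → ℝ} (hc : Continuous c)
    (hd : ∀ t, HasDerivAt h (h t * c t) t) (t : ℝ) :
    h t = h 0 * Real.exp (∫ s in (0 : ℝ)..t, c s) := by
  have hI : ∀ t, HasDerivAt (fun t => ∫ s in (0 : ℝ)..t, c s) (c t) t := fun t =>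
    intervalIntegral.integral_hasDerivAt_right (hc.intervalIntegrable _ _)
      (hc.stronglyMeasurableAtFilter _ _) hc.continuousAt
  have hg : ∀ t, HasDerivAt (fun t => h t * Real.exp (-∫ s in (0 : ℝ)..t, c s)) 0 t := by
    intro t
    refine ((hd t).mul (hI t).fun_neg.exp).congr_deriv ?_
    ring
  have := is_const_of_deriv_eq_zero (fun t => (hg t).differentiableAt) (fun t => (hg t).deriv) t 0
  simp only [intervalIntegral.integral_same, neg_zero, Real.exp_zero, mul_one] at this
  rw [← this, mul_assoc, ← Real.exp_add]
  simp

theorem le_mul_exp_of_hasDerivAt {h c : ℝ → ℝ} (hc : Continuous c)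
    (hd : ∀ t, HasDerivAt h (h t * c t) t) {k t : ℝ} (ht : 0 ≤ t) (h0 : 0 ≤ h 0)
    (hk : ∀ s ∈ Icc 0 t, c s ≤ -k) : h t ≤ h 0 * Real.exp (-k * t) := by
  rw [eq_mul_exp_of_hasDerivAt hc hd t]
  refine mul_le_mul_of_nonneg_left (Real.exp_le_exp.2 ?_) h0
  calc ∫ s in (0 : ℝ)..t, c s ≤ ∫ s in (0 : ℝ)..t, -k :=
        intervalIntegral.integral_mono_on ht (hc.intervalIntegrable _ _) (by simp) hk
    _ = -k * t := by simp [mul_comm]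

theorem IsFlow.continuous {φ : ℝ → X → X} {v : VField E X} (hφ : IsFlow φ v) :
    Continuous fun p : ℝ × X => φ p.1 p.2 := hφ.smooth.continuous

theorem IsFlow.continuous_right {φ : ℝ → X → X} {v : VField E X} (hφ : IsFlow φ v) (t : ℝ) :
    Continuous (φ t) := hφ.continuous.comp (Continuous.prodMk_right t)

theorem IsFlow.continuous_left {φ : ℝ → X → X} {v : VField E X} (hφ : IsFlow φ v) (x : X) :
    Continuous fun t => φ t x := hφ.continuous.comp (Continuous.prodMk_left x)

variable [IsManifold 𝓘(ℝ, E) ∞ X]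

theorem SmoothField.contMDiff_one {v : VField E X} (hv : SmoothField v) :
    ContMDiff 𝓘(ℝ, E) 𝓘(ℝ, E).tangent 1 (fun x => (⟨x, v x⟩ : TangentBundle 𝓘(ℝ, E) X)) :=
  ContMDiff.of_le hv (by norm_cast)

theorem IsFlow.map_add [T2Space X] {φ : ℝ → X → X} {v : VField E X} (hφ : IsFlow φ v)
    (hv : SmoothField v) (s t : ℝ) (x : X) : φ (s + t) x = φ s (φ t x) := by
  have h := isMIntegralCurve_Ioo_eq_of_contMDiff_boundaryless (t₀ := 0) hv.contMDiff_one
    ((hφ.integral x).comp_add t) (hφ.integral (φ t x)) (by simp [hφ.map_zero])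
  exact congrFun h s

section Hamiltonian

variable {lam : OneForm E X} {R v : VField E X} {H : X → ℝ} {φ : ℝ → X → X} {W : Set X}

theorem hasDerivAt_hamiltonian_flow (hR : IsReeb lam R) (hH : SmoothFun E H)
    (hv : IsContactField lam H v) (hφ : IsFlow φ v) (x : X) (t : ℝ) :
    HasDerivAt (fun s => H (φ s x)) (H (φ t x) * dFun H (φ t x) (R (φ t x))) t := by
  rw [← dFun_contactField hR hv]
  exact hasDerivAt_comp_curve (hH.mdifferentiableAt _) (hφ.integral x t)

theorem continuous_dFun_flow (hR : IsReeb lam R) (hH : SmoothFun E H) (hφ : IsFlow φ v) (x : X) :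
    Continuous fun t => dFun H (φ t x) (R (φ t x)) :=
  (continuous_dFun hH hR.smooth).comp (hφ.continuous_left x)

theorem hamiltonian_flow_eq (hR : IsReeb lam R) (hH : SmoothFun E H)
    (hv : IsContactField lam H v) (hφ : IsFlow φ v) (x : X) (t : ℝ) :
    ∃ c > 0, H (φ t x) = H x * c := by
  have h := eq_mul_exp_of_hasDerivAt (continuous_dFun_flow hR hH hφ x)
    (hasDerivAt_hamiltonian_flow hR hH hv hφ x) t
  rw [hφ.map_zero] at h
  exact ⟨_, Real.exp_pos _, h⟩

theorem hamiltonian_flow_le (hR : IsReeb lam R) (hH : SmoothFun E H)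
    (hv : IsContactField lam H v) (hφ : IsFlow φ v) {x : X} {k t : ℝ} (ht : 0 ≤ t) (h0 : 0 ≤ H x)
    (hk : ∀ s ∈ Icc 0 t, dFun H (φ s x) (R (φ s x)) ≤ -k) :
    H (φ t x) ≤ H x * Real.exp (-k * t) := by
  have h := le_mul_exp_of_hasDerivAt (continuous_dFun_flow hR hH hφ x)
    (hasDerivAt_hamiltonian_flow hR hH hv hφ x) ht (by rwa [hφ.map_zero]) hk
  rwa [hφ.map_zero] at h

/-! ### The nodal domain and its boundary under the flow -/

theorem IsPositiveDomain.pos (hW : IsPositiveDomain H W) {x : X} (hx : x ∈ W) : 0 < H x := by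
  obtain ⟨x₀, _, rfl⟩ := hW
  have h : x ∈ {y | 0 < H y} := connectedComponentIn_subset _ _ hx
  exact h

theorem IsPositiveDomain.isOpen [LocallyConnectedSpace X] (hH : Continuous H)
    (hW : IsPositiveDomain H W) : IsOpen W := by
  obtain ⟨x₀, _, rfl⟩ := hW
  exact (isOpen_lt continuous_const hH).connectedComponentIn

theorem IsPositiveDomain.eq_zero_of_mem_frontier [LocallyConnectedSpace X] (hH : Continuous H)
    (hW : IsPositiveDomain H W) {x : X} (hx : x ∈ frontier W) : H x = 0 := by
  have hWo := hW.isOpen hH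
  have hpos := fun y (hy : y ∈ W) => hW.pos hy
  obtain ⟨x₀, hx₀, rfl⟩ := hW
  have hopen : IsOpen {y | 0 < H y} := isOpen_lt continuous_const hH
  rw [hWo.frontier_eq] at hx
  refine le_antisymm (not_lt.1 fun hlt => hx.2 ?_) ?_
  -- If `H x > 0`, the component of `x` is open and meets W, so it is W, although `x` is not in W.
  · obtain ⟨y, hy1, hy2⟩ := mem_closure_iff.1 hx.1 _ hopen.connectedComponentIn
      (mem_connectedComponentIn hlt)
    rw [connectedComponentIn_eq hy2, ← connectedComponentIn_eq hy1]
    exact mem_connectedComponentIn hlt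
  · exact closure_minimal (fun y hy => (hpos y hy).le) (isClosed_le continuous_const hH) hx.1

theorem IsPositiveDomain.flow_mem (hR : IsReeb lam R) (hH : SmoothFun E H)
    (hv : IsContactField lam H v) (hφ : IsFlow φ v) (hW : IsPositiveDomain H W)
    {x : X} (hx : x ∈ W) (t : ℝ) : φ t x ∈ W := by
  have hpos := hW.pos hx
  obtain ⟨x₀, _, rfl⟩ := hW
  have hsub : range (fun t => φ t x) ⊆ {y | 0 < H y} := by
    rintro _ ⟨s, rfl⟩
    obtain ⟨c, hc, h⟩ := hamiltonian_flow_eq hR hH hv hφ x s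
    rw [mem_ofPred_eq, h]
    positivity
  rw [connectedComponentIn_eq hx]
  exact (isPreconnected_range (hφ.continuous_left x)).subset_connectedComponentIn
    ⟨0, hφ.map_zero x⟩ hsub ⟨t, rfl⟩

theorem IsPositiveDomain.flow_mem_closure (hR : IsReeb lam R) (hH : SmoothFun E H)
    (hv : IsContactField lam H v) (hφ : IsFlow φ v) (hW : IsPositiveDomain H W)
    {x : X} (hx : x ∈ closure W) (t : ℝ) : φ t x ∈ closure W :=
  map_mem_closure (hφ.continuous_right t) hx fun _ hy => hW.flow_mem hR hH hv hφ hy t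

theorem IsPositiveDomain.mem_frontier_iff [LocallyConnectedSpace X] (hH : Continuous H)
    (hW : IsPositiveDomain H W) {x : X} : x ∈ frontier W ↔ x ∈ closure W ∧ H x = 0 := by
  refine ⟨fun h => ⟨frontier_subset_closure h, hW.eq_zero_of_mem_frontier hH h⟩, fun h => ?_⟩
  rw [(hW.isOpen hH).frontier_eq]
  exact ⟨h.1, fun hx => (hW.pos hx).ne' h.2⟩

theorem IsPositiveDomain.flow_mem_frontier [LocallyConnectedSpace X] (hR : IsReeb lam R)
    (hH : SmoothFun E H) (hv : IsContactField lam H v) (hφ : IsFlow φ v)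
    (hW : IsPositiveDomain H W) {x : X} (hx : x ∈ frontier W) (t : ℝ) : φ t x ∈ frontier W := by
  rw [hW.mem_frontier_iff hH.continuous] at hx ⊢
  refine ⟨hW.flow_mem_closure hR hH hv hφ hx.1 t, ?_⟩
  obtain ⟨c, _, h⟩ := hamiltonian_flow_eq hR hH hv hφ x t
  rw [h, hx.2, zero_mul]

/-- The flow maps `M₋ ∪ Γ` into `M₋` in positive time. -/
theorem CrossesIntoNeg.flow_mem_negPart [T2Space X] {M : Set X} (hR : IsReeb lam R)
    (hH : SmoothFun E H) (hv : IsContactField lam H v) (hφ : IsFlow φ v)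
    (hM : ∀ x ∈ M, ∀ t, φ t x ∈ M) (hΓ : CrossesIntoNeg H R v φ M) {x : X} (hx : x ∈ M)
    (hx0 : dFun H x (R x) ≤ 0) {t : ℝ} (ht : 0 < t) : φ t x ∈ negPart H R M := by
  have main : ∀ x ∈ M, dFun H x (R x) < 0 → ∀ t, 0 ≤ t → φ t x ∈ negPart H R M := by
    intro x hx hx0 t ht
    refine ⟨hM x hx t, not_le.1 fun hcon => ?_⟩
    have hc := continuous_dFun_flow hR hH hφ x
    -- At the first time when ρ ≥ 0 the trajectory is on Γ, and `before` makes ρ positive just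
    -- earlier, a contradiction.
    obtain ⟨s, ⟨hs, hs0⟩, hmin⟩ := (isCompact_Icc.inter_right
      (isClosed_le continuous_const hc)).exists_isLeast
      (s := Icc 0 t ∩ {s | 0 ≤ dFun H (φ s x) (R (φ s x))}) ⟨t, ⟨ht, le_rfl⟩, hcon⟩
    have hlt : ∀ r, 0 ≤ r → r < s → dFun H (φ r x) (R (φ r x)) < 0 := fun r hr hrs =>
      not_le.1 fun h => absurd (hmin ⟨⟨hr, hrs.le.trans hs.2⟩, h⟩) (not_le.2 hrs)
    have hspos : 0 < s := by
      refine lt_of_le_of_ne hs.1 ?_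
      rintro rfl
      rw [mem_ofPred_eq, hφ.map_zero] at hs0
      linarith
    have hev : ∀ᶠ r in 𝓝[<] s, r ∈ Ioo 0 s := Ioo_mem_nhdsLT hspos
    have hsle : dFun H (φ s x) (R (φ s x)) ≤ 0 :=
      le_of_tendsto ((hc.tendsto s).mono_left nhdsWithin_le_nhds)
        (hev.mono fun r hr => (hlt r hr.1.le hr.2).le)
    have hb := hΓ.before (φ s x) ⟨hM x hx s, le_antisymm hsle hs0⟩
    have hev' : ∀ᶠ r in 𝓝[<] (0 : ℝ), r ∈ Ioo (-s) 0 := Ioo_mem_nhdsLT (by linarith)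
    obtain ⟨r, hr1, hr2⟩ := (hb.and hev').exists
    have h1 := hr1.2
    rw [← hφ.map_add hv.smooth] at h1
    exact absurd h1 (hlt (r + s) (by linarith [hr2.1]) (by linarith [hr2.2])).not_gt
  rcases hx0.lt_or_eq with hlt | heq
  · exact main x hx hlt t ht.le
  · have hev : ∀ᶠ r in 𝓝[>] (0 : ℝ), r ∈ Ioo 0 t := Ioo_mem_nhdsGT ht
    obtain ⟨r, hr1, hr2⟩ := ((hΓ.after x ⟨hx, heq⟩).and hev).exists
    have := main _ hr1.1 hr1.2 (t - r) (by linarith [hr2.2])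
    rwa [← hφ.map_add hv.smooth, sub_add_cancel] at this

/-- The points of `W` near `M₋ ∪ Γ` have trajectories that converge to the core. -/
theorem exists_isOpen_tendsto_negCore [T2Space X] [LocallyCompactSpace X] [LocallyConnectedSpace X]
    (hR : IsReeb lam R) (hH : SmoothFun E H) (hv : IsContactField lam H v) (hφ : IsFlow φ v)
    (hW : IsPositiveDomain H W) (hMc : IsCompact (frontier W))
    (hΓ : CrossesIntoNeg H R v φ (frontier W)) :
    ∃ O : Set X, IsOpen O ∧ (∀ x ∈ frontier W, dFun H x (R x) ≤ 0 → x ∈ O) ∧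
      ∀ y ∈ O ∩ W, Tendsto (fun t => φ t y) atTop (𝓝ˢ (negCore H R φ (frontier W))) := by
  have hHc := hH.continuous
  have hρ := continuous_dFun hH hR.smooth
  have hneg := fun {x : X} (hx : x ∈ frontier W) (hx0 : dFun H x (R x) ≤ 0) {t : ℝ} (ht : 0 < t) =>
    hΓ.flow_mem_negPart hR hH hv hφ (fun x hx t => hW.flow_mem_frontier hR hH hv hφ hx t) hx hx0 ht
  have hP : IsCompact (frontier W ∩ {x | dFun H x (R x) ≤ 0}) :=
    hMc.inter_right (isClosed_le hρ continuous_const)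
  -- The time-one map sends the compact set M₋ ∪ Γ into the open condition ρ < 0, which leaves room
  -- for a compact neighbourhood `C` of the image.
  obtain ⟨C, hC, hPC, hC0⟩ := exists_compact_between (hP.image (hφ.continuous_right 1))
    (isOpen_lt hρ continuous_const : IsOpen {x | dFun H x (R x) < 0}) (by
      rintro _ ⟨x, hx, rfl⟩
      exact (hneg hx.1 hx.2 one_pos).2)
  have hC0' : ∀ x ∈ C, dFun H x (R x) < 0 := fun x hx => hC0 hx
  set G : Set X := {x | ∀ t ∈ Icc (0 : ℝ) 1, dFun H (φ t x) (R (φ t x)) < 0} ∩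
    φ 1 ⁻¹' interior C with hG
  have hGo : IsOpen G := by
    refine IsOpen.inter ?_ (isOpen_interior.preimage (hφ.continuous_right 1))
    rw [isOpen_iff_mem_nhds]
    intro x hx
    refine isCompact_Icc.eventually_forall_of_forall_eventually fun t ht => ?_
    have : Continuous fun p : X × ℝ => dFun H (φ p.2 p.1) (R (φ p.2 p.1)) :=
      hρ.comp (hφ.continuous.comp continuous_swap)
    exact this.continuousAt.eventually (gt_mem_nhds (hx t ht))
  have hCG : ∀ x ∈ C, x ∈ frontier W → x ∈ G := by
    refine fun x hx hxM => ⟨fun t ht => ?_, hPC ⟨x, ⟨hxM, (hC0' x hx).le⟩, rfl⟩⟩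
    rcases ht.1.eq_or_lt with rfl | h0
    · rw [hφ.map_zero]
      exact hC0' x hx
    · exact (hneg hxM (hC0' x hx).le h0).2
  -- Points of M in `C` lie in `G`, so the compact remainder of `C ∩ closure W` lies inside W, where
  -- `H` is positive.
  obtain ⟨δ, hδ, hδG⟩ := ((hC.inter_right isClosed_closure).inter_right
    hGo.isClosed_compl).exists_pos_forall_lt (S := C ∩ closure W ∩ Gᶜ) hHc (by
      rintro x ⟨⟨hxC, hxW⟩, hxG⟩
      by_contra hcon
      by_cases hx : x ∈ W
      · exact hcon (hW.pos hx)
      · refine hxG (hCG x hxC ?_)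
        rw [(hW.isOpen hHc).frontier_eq]
        exact ⟨hxW, hx⟩)
  have hnonneg : ∀ x ∈ closure W, 0 ≤ H x := fun x hx =>
    closure_minimal (fun y hy => (hW.pos hy).le) (isClosed_le continuous_const hHc) hx
  -- A trap for the time-one map: on `D ⊆ G` the image returns to `C`, and `H` does not increase
  -- since ρ < 0 on the way.
  set D : Set X := (C ∩ closure W) ∩ {x | H x ≤ δ} with hD
  have hDc : IsCompact D :=
    (hC.inter_right isClosed_closure).inter_right (isClosed_le hHc continuous_const)
  have hDG : ∀ x ∈ D, x ∈ G := fun x hx => by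
    by_contra hxG
    exact absurd (hδG x ⟨hx.1, hxG⟩) (not_lt.2 hx.2)
  have hD1 : ∀ x ∈ D, φ 1 x ∈ D := fun x hx => by
    refine ⟨⟨interior_subset (hDG x hx).2, hW.flow_mem_closure hR hH hv hφ hx.1.2 1⟩, ?_⟩
    have := hamiltonian_flow_le hR hH hv hφ (k := 0) zero_le_one (hnonneg x hx.1.2)
      (fun s hs => by simpa using ((hDG x hx).1 s hs).le)
    simp only [neg_zero, Real.exp_zero, mul_one] at this
    exact this.trans hx.2
  have hDn : ∀ (n : ℕ), ∀ x ∈ D, φ n x ∈ D := by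
    intro n x hx
    induction n with
    | zero => simpa [hφ.map_zero] using hx
    | succ n ih =>
      rw [Nat.cast_succ, add_comm, hφ.map_add hv.smooth]
      exact hD1 _ ih
  -- The trajectories over unit time fill the gaps between integer times, giving a compact set that
  -- contains all forward trajectories from `D`. There ρ < -k, so `H` tends to 0.
  set D' : Set X := (fun p : ℝ × X => φ p.1 p.2) '' (Icc 0 1 ×ˢ D) with hD'
  have hD'c : IsCompact D' := (isCompact_Icc.prod hDc).image hφ.continuous
  have hDD' : ∀ x ∈ D, ∀ t, 0 ≤ t → φ t x ∈ D' := by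
    intro x hx t ht
    refine ⟨(t - ⌊t⌋₊, φ ⌊t⌋₊ x), ⟨⟨?_, ?_⟩, hDn _ x hx⟩, ?_⟩
    · simpa using Nat.floor_le ht
    · have := (Nat.lt_floor_add_one t).le
      simp only
      linarith
    · simp only
      rw [← hφ.map_add hv.smooth, sub_add_cancel]
  obtain ⟨k, hk, hkD'⟩ := hD'c.exists_pos_forall_lt (f := fun x => -dFun H x (R x)) hρ.neg (by
    rintro _ ⟨⟨t, x⟩, ⟨ht, hx⟩, rfl⟩
    simpa using (hDG x hx).1 t ht)
  have hlim : ∀ x ∈ D, Tendsto (fun t => φ t x) atTop (𝓝ˢ (negCore H R φ (frontier W))) := by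
    intro x hx
    have hH0 : Tendsto (fun t => H (φ t x)) atTop (𝓝 0) := by
      have hexp : Tendsto (fun t : ℝ => H x * Real.exp (-k * t)) atTop (𝓝 0) := by
        have h1 : Tendsto (fun t : ℝ => -k * t) atTop atBot :=
          tendsto_id.const_mul_atTop_of_neg (by linarith)
        simpa using (Real.tendsto_exp_atBot.comp h1).const_mul (H x)
      refine tendsto_of_tendsto_of_tendsto_of_le_of_le' tendsto_const_nhds hexp
        (Eventually.of_forall fun t => hnonneg _ (hW.flow_mem_closure hR hH hv hφ hx.1.2 t)) ?_
      filter_upwards [eventually_ge_atTop 0] with t ht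
      refine hamiltonian_flow_le hR hH hv hφ ht (hnonneg x hx.1.2) fun s hs => ?_
      have := hkD' _ (hDD' x hx s hs.1)
      linarith
    have hcl : ∀ z, MapClusterPt z atTop (fun t => φ t x) → z ∈ negPart H R (frontier W) := by
      intro z hz
      have hzD : z ∈ D' := hD'c.isClosed.mem_of_mapClusterPt hz
        ((eventually_ge_atTop 0).mono fun t ht => hDD' x hx t ht)
      have hzW : z ∈ closure W := isClosed_closure.mem_of_mapClusterPt hz
        (Eventually.of_forall fun t => hW.flow_mem_closure hR hH hv hφ hx.1.2 t)
      have hzH : H z = 0 := by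
        have h1 : MapClusterPt (H z) atTop (H ∘ fun t => φ t x) :=
          hz.continuousAt_comp hHc.continuousAt
        exact eq_of_nhds_neBot (ClusterPt.mono h1 hH0)
      refine ⟨(hW.mem_frontier_iff hHc).2 ⟨hzW, hzH⟩, ?_⟩
      have := hkD' z hzD
      linarith
    have hcore : ∀ z, MapClusterPt z atTop (fun t => φ t x) →
        z ∈ negCore H R φ (frontier W) := by
      intro z hz
      simp only [negCore, mem_iInter]
      intro s _
      refine ⟨φ (-s) z, hcl _ ?_, ?_⟩
      -- Cluster points of a trajectory are invariant under every φ^(-s), and all of them lie in M₋;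
      -- hence they lie in each φ^s(M₋).
      · have h1 : MapClusterPt (φ (-s) z) atTop (φ (-s) ∘ fun t => φ t x) :=
          hz.continuousAt_comp (hφ.continuous_right (-s)).continuousAt
        have h2 : (φ (-s) ∘ fun t => φ t x) = (fun t => φ t x) ∘ fun t => -s + t := by
          funext t
          exact (hφ.map_add hv.smooth (-s) t x).symm
        rw [h2] at h1
        exact h1.of_comp (tendsto_atTop_add_const_left _ _ tendsto_id)
      · rw [← hφ.map_add hv.smooth, add_neg_cancel, hφ.map_zero]
    rw [(hasBasis_nhdsSet _).tendsto_right_iff]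
    rintro V ⟨hV, hΛV⟩
    by_contra hcon
    obtain ⟨z, hz, hzc⟩ := (hD'c.inter_right hV.isClosed_compl).exists_mapClusterPt_of_frequently
      (f := fun t => φ t x) (l := atTop) (((not_eventually.1 hcon).and_eventually
        (eventually_ge_atTop 0)).mono fun t ht => ⟨hDD' x hx t ht.2, ht.1⟩)
    exact hz.2 (hΛV (hcore z hzc))
  -- Points whose time-one image falls into the trap `D`; this includes a neighbourhood of Γ, where
  -- ρ need not be negative.
  refine ⟨φ 1 ⁻¹' (interior C ∩ {x | H x < δ}), (isOpen_interior.inter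
    (isOpen_lt hHc continuous_const)).preimage (hφ.continuous_right 1), ?_, ?_⟩
  · refine fun x hx hx0 => ⟨hPC ⟨x, ⟨hx, hx0⟩, rfl⟩, ?_⟩
    rw [mem_ofPred_eq, hW.eq_zero_of_mem_frontier hHc (hW.flow_mem_frontier hR hH hv hφ hx 1)]
    exact hδ
  · rintro y ⟨hyO, hyW⟩
    have h1 := hlim (φ 1 y) ⟨⟨interior_subset hyO.1,
      subset_closure (hW.flow_mem hR hH hv hφ hyW 1)⟩, (le_of_lt hyO.2 : H (φ 1 y) ≤ δ)⟩
    have h2 := h1.comp (tendsto_atTop_add_const_right atTop (-1 : ℝ) tendsto_id)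
    refine h2.congr fun t => ?_
    simp only [Function.comp_apply, id]
    rw [← hφ.map_add hv.smooth, neg_add_cancel_right]

end Hamiltonian

end

section

/-! ### Truncation of the Hamiltonian -/

/-- The identity is blended with the constant δ/3 over [δ/3, 2δ/3]. The correction added to δ/3
vanishes below δ/3 and is nonnegative above, hence positivity. -/
theorem exists_smooth_truncation {δ : ℝ} (hδ : 0 < δ) :
    ∃ f : ℝ → ℝ, ContDiff ℝ ∞ f ∧ (∀ s < δ / 3, f s = δ / 3) ∧ (∀ s, δ < s → f s = s) ∧
      ∀ s, 0 < f s := by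
  refine ⟨fun s => δ / 3 + Real.smoothTransition ((s - δ / 3) / (δ / 3)) * (s - δ / 3),
    ?_, fun s hs => ?_, fun s hs => ?_, fun s => ?_⟩
  · exact contDiff_const.add ((Real.smoothTransition.contDiff.comp
      ((contDiff_id.sub contDiff_const).div_const _)).mul (contDiff_id.sub contDiff_const))
  · simp only
    rw [Real.smoothTransition.zero_of_nonpos
      (div_nonpos_of_nonpos_of_nonneg (by linarith) (by linarith))]
    ring
  · simp only
    rw [Real.smoothTransition.one_of_one_le ((one_le_div (by linarith)).2 (by linarith))]
    ring
  · simp only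
    rcases le_total s (δ / 3) with hs | hs
    · rw [Real.smoothTransition.zero_of_nonpos
        (div_nonpos_of_nonpos_of_nonneg (by linarith) (by linarith))]
      linarith
    · have := mul_nonneg (Real.smoothTransition.nonneg ((s - δ / 3) / (δ / 3)))
        (sub_nonneg.2 hs)
      linarith

theorem compField_congr {f g : ℝ → ℝ} {H : X → ℝ} {x : X} (h : f =ᶠ[𝓝 (H x)] g)
    (R v : VField E X) : compField f H R v x = compField g H R v x := by
  rw [compField_apply, compField_apply, h.eq_of_nhds, h.deriv_eq]

theorem compField_id (H : X → ℝ) (R v : VField E X) (x : X) :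
    compField (fun s => s) H R v x = v x := by
  rw [compField_apply]
  simp

theorem compField_const (c : ℝ) (H : X → ℝ) (R v : VField E X) (x : X) :
    compField (fun _ => c) H R v x = c • R x := by
  rw [compField_apply]
  simp

variable [IsManifold 𝓘(ℝ, E) ∞ X] {lam : OneForm E X} {R v : VField E X} {H : X → ℝ}
  {φ : ℝ → X → X} {W : Set X}

open Classical in
/-- A positive Hamiltonian that agrees with `H` on `W`, away from the points near the boundary of
`W` where `H` is small, and is constant outside of `W`. -/
theorem exists_truncated_contactField [LocallyConnectedSpace X] (hR : IsReeb lam R)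
    (hH : SmoothFun E H) (hv : IsContactField lam H v) (hW : IsPositiveDomain H W)
    {N : Set X} (hN : IsClosed N) (hWN : frontier W ⊆ interior N) {δ : ℝ} (hδ : 0 < δ)
    (hNδ : ∀ x ∈ frontier N ∩ closure W, δ < H x) :
    ∃ (F : X → ℝ) (u : VField E X) (c : ℝ), SmoothFun E F ∧ IsContactField lam F u ∧
      (∀ x, 0 < F x) ∧ (∀ x ∈ W, (x ∈ N → δ < H x) → u x = v x) ∧ ∀ x ∉ W, u x = c • R x := by
  have hHc := hH.continuous
  have hWo := hW.isOpen hHc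
  obtain ⟨f, hf, hf0, hf1, hfpos⟩ := exists_smooth_truncation hδ
  have hfid : ∀ {s}, δ < s → f =ᶠ[𝓝 s] fun s => s := fun {s} hs =>
    (lt_mem_nhds hs).mono fun r hr => hf1 r hr
  have hfc : ∀ {s}, s < δ / 3 → f =ᶠ[𝓝 s] fun _ => δ / 3 := fun {s} hs =>
    (gt_mem_nhds hs).mono fun r hr => hf0 r hr
  -- `H` is truncated only inside `N`, since it may also be small far from M in a noncompact W. The
  -- three profiles match as germs: near M, H < δ/3; on the frontier of `N` in `closure W`, H > δ.
  set sel : X → ℝ → ℝ := fun x =>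
    if x ∈ W then (if x ∈ N then f else fun s => s) else fun _ => δ / 3 with hsel
  have hsel1 : ∀ {x}, x ∈ W → x ∈ N → sel x = f := fun h h' => by simp [hsel, h, h']
  have hsel2 : ∀ {x}, x ∈ W → x ∉ N → sel x = fun s => s := fun h h' => by simp [hsel, h, h']
  have hsel3 : ∀ {x}, x ∉ W → sel x = fun _ => δ / 3 := fun h => by simp [hsel, h]
  have hloc : ∀ x, ∃ g : ℝ → ℝ, ContDiff ℝ ∞ g ∧ ∀ᶠ y in 𝓝 x, sel y =ᶠ[𝓝 (H y)] g := by
    intro x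
    by_cases hxc : x ∈ closure W
    swap
    · refine ⟨_, contDiff_const (c := δ / 3), ?_⟩
      filter_upwards [isClosed_closure.isOpen_compl.mem_nhds hxc] with y hy
      rw [hsel3 fun h => hy (subset_closure h)]
    by_cases hxW : x ∈ W
    swap
    · have hxf : x ∈ frontier W := by
        rw [hWo.frontier_eq]
        exact ⟨hxc, hxW⟩
      have hx0 : H x < δ / 3 := by
        rw [hW.eq_zero_of_mem_frontier hHc hxf]
        positivity
      refine ⟨_, contDiff_const (c := δ / 3), ?_⟩
      filter_upwards [isOpen_interior.mem_nhds (hWN hxf),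
        (isOpen_lt hHc continuous_const).mem_nhds hx0] with y hyN hy
      by_cases hyW : y ∈ W
      · rw [hsel1 hyW (interior_subset hyN)]
        exact hfc hy
      · rw [hsel3 hyW]
    by_cases hxN : x ∈ N
    swap
    · refine ⟨_, contDiff_id, ?_⟩
      filter_upwards [hWo.mem_nhds hxW, hN.isOpen_compl.mem_nhds hxN] with y hy hyN
      rw [hsel2 hy hyN]
      rfl
    by_cases hxi : x ∈ interior N
    · refine ⟨f, hf, ?_⟩
      filter_upwards [hWo.mem_nhds hxW, isOpen_interior.mem_nhds hxi] with y hy hyN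
      rw [hsel1 hy (interior_subset hyN)]
    · have hxδ : δ < H x := hNδ x ⟨⟨subset_closure hxN, hxi⟩, hxc⟩
      refine ⟨fun s => s, contDiff_id, ?_⟩
      filter_upwards [hWo.mem_nhds hxW, (isOpen_lt continuous_const hHc).mem_nhds hxδ] with y hy hyδ
      by_cases hyN : y ∈ N
      · rw [hsel1 hy hyN]
        exact hfid hyδ
      · rw [hsel2 hy hyN]
  obtain ⟨hF, hu⟩ := isContactField_of_locally_compField hH hR hv (F := fun x => sel x (H x))
    (u := fun x => compField (sel x) H R v x) fun x => by
      obtain ⟨g, hg, hx⟩ := hloc x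
      exact ⟨g, hg, hx.mono fun y hy => ⟨hy.eq_of_nhds, compField_congr hy R v⟩⟩
  refine ⟨_, _, δ / 3, hF, hu, fun x => ?_, fun x hx hxN => ?_, fun x hx => ?_⟩
  · by_cases hxW : x ∈ W
    · by_cases hxN : x ∈ N
      · rw [hsel1 hxW hxN]
        exact hfpos _
      · rw [hsel2 hxW hxN]
        exact hW.pos hxW
    · rw [hsel3 hxW]
      positivity
  · rw [← compField_id H R v x]
    by_cases hxN' : x ∈ N
    · rw [hsel1 hx hxN']
      exact compField_congr (hfid (hxN hxN')) R v
    · rw [hsel2 hx hxN']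
  · rw [← compField_const (δ / 3) H R v x, hsel3 hx]

/-- A field that agrees with `v` on the part of `W` outside of a compact set containing the boundary
of `W`, and with a multiple of `R` outside of `W`, is complete. -/
theorem completeField_of_eq_flow [CompleteSpace E] [T2Space X] [LocallyCompactSpace X]
    (hRc : CompleteField R) (hφ : IsFlow φ v) (hWo : IsOpen W) (hWφ : ∀ x ∈ W, ∀ t, φ t x ∈ W)
    {Z : Set X} (hZ : IsCompact Z) (hWZ : frontier W ⊆ Z) {u : VField E X} (hu : SmoothField u)
    {c : ℝ} (huv : ∀ x ∈ W, x ∉ Z → u x = v x) (huR : ∀ x ∉ W, u x = c • R x) :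
    CompleteField u := by
  refine completeField_of_isCompact hu.contMDiff_one hZ fun x hxZ => ?_
  by_cases hxW : x ∈ W
  · refine ⟨fun t => φ t x, hφ.map_zero x, (hφ.integral x).continuous, fun t ht => ?_⟩
    rw [huv _ (hWφ x hxW t) (ht t right_mem_uIcc)]
    exact hφ.integral x t
  · obtain ⟨γ, h0, hγ⟩ := hRc x
    have hγ' := hγ.comp_mul c
    refine ⟨γ ∘ (· * c), by simp [h0], hγ'.continuous, fun t ht => ?_⟩
    -- To enter W, the rescaled Reeb curve would have to cross ∂W, which lies in `Z`.
    have htW : (γ ∘ (· * c)) t ∉ W := by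
      intro htW
      have hsub := subset_of_isPreconnected_of_disjoint_frontier
        (isPreconnected_uIcc.image (γ ∘ (· * c)) hγ'.continuous.continuousOn (s := uIcc 0 t)) hWo
        ⟨_, ⟨t, right_mem_uIcc, rfl⟩, htW⟩ (by
          rw [disjoint_left]
          rintro _ ⟨s, hs, rfl⟩ hf
          exact ht s hs (hWZ hf))
      exact hxW (by simpa [h0] using hsub ⟨0, left_mem_uIcc, rfl⟩)
    rw [huR _ htW]
    exact hγ' t

theorem nonpos_of_hasDerivAt_of_eventually_le {f : ℝ → ℝ} {d t : ℝ} (hd : HasDerivAt f d t)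
    (h : ∀ᶠ s in 𝓝[<] t, f t ≤ f s) : d ≤ 0 := by
  have h1 : Tendsto (slope f t) (𝓝[<] t) (𝓝 d) :=
    (hasDerivAt_iff_tendsto_slope.1 hd).mono_left
      (nhdsWithin_mono _ fun s hs => (ne_of_lt hs : s ≠ t))
  refine le_of_tendsto h1 ?_
  filter_upwards [h, self_mem_nhdsWithin] with s hs hst
  rw [slope_def_field]
  exact div_nonpos_of_nonneg_of_nonpos (sub_nonneg.2 hs) (sub_nonpos.2 (le_of_lt hst))

/-- If a compact set `K ⊆ W` is linked to the core of `M₋`, for all contact forms, by trajectories of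
the Reeb flow, then some trajectory of `φ` that starts on `K` converges to the core. -/
theorem exists_tendsto_negCore [CompleteSpace E] [T2Space X] [LocallyCompactSpace X]
    [LocallyConnectedSpace X] (hlam : lam.Smooth) (hR : IsReeb lam R) (hRc : CompleteField R)
    (hH : SmoothFun E H) (hv : IsContactField lam H v) (hφ : IsFlow φ v)
    (hW : IsPositiveDomain H W) (hMc : IsCompact (frontier W))
    (hΓ : CrossesIntoNeg H R v φ (frontier W)) {K : Set X} (hK : IsCompact K) (hKW : K ⊆ W)
    (hlink : ∀ (g : X → ℝ) (R' : VField E X), SmoothFun E g → (∀ x, 0 < g x) →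
      IsReeb (OneForm.rescale g lam) R' → CompleteField R' →
      ∃ (γ : ℝ → X) (T : ℝ), IsMIntegralCurve γ R' ∧ 0 ≤ T ∧ γ 0 ∈ K ∧
        γ T ∈ negCore H R φ (frontier W)) :
    ∃ x ∈ K, Tendsto (fun t => φ t x) atTop (𝓝ˢ (negCore H R φ (frontier W))) := by
  have hHc := hH.continuous
  have hWo := hW.isOpen hHc
  have hρ := continuous_dFun hH hR.smooth
  obtain ⟨O, hO, hMO, hOlim⟩ := exists_isOpen_tendsto_negCore hR hH hv hφ hW hMc hΓ
  have hMW : Disjoint (frontier W) W := by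
    rw [hWo.frontier_eq]
    exact disjoint_sdiff_left
  -- M is covered by `O` and {ρ > 0} and is disjoint from `K`, so the collar `N` can be chosen with
  -- the same properties.
  obtain ⟨N, hN, hMN, hNO⟩ := exists_compact_between hMc
    ((hO.union (isOpen_lt continuous_const hρ)).inter hK.isClosed.isOpen_compl) (fun x hx =>
      ⟨(le_or_gt (dFun H x (R x)) 0).imp (hMO x hx) id,
        fun hxK => disjoint_left.1 hMW hx (hKW hxK)⟩)
  obtain ⟨δ, hδ, hNδ⟩ := ((hN.of_isClosed_subset isClosed_frontier
    hN.isClosed.frontier_subset).inter_right isClosed_closure).exists_pos_forall_lt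
    (S := frontier N ∩ closure W) hHc (by
      rintro x ⟨hxN, hxW⟩
      by_contra hcon
      have hxf : x ∈ frontier W := by
        rw [hWo.frontier_eq]
        exact ⟨hxW, fun h => hcon (hW.pos h)⟩
      exact hxN.2 (hMN hxf))
  obtain ⟨F, u, c, hF, hu, hFpos, huv, huR⟩ :=
    exists_truncated_contactField hR hH hv hW hN.isClosed hMN hδ hNδ
  set Z : Set X := (N ∩ closure W) ∩ {x | H x ≤ δ} with hZ
  have hZc : IsCompact Z :=
    (hN.inter_right isClosed_closure).inter_right (isClosed_le hHc continuous_const)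
  have hMZ : frontier W ⊆ Z := fun x hx => by
    refine ⟨⟨interior_subset (hMN hx), frontier_subset_closure hx⟩, ?_⟩
    rw [mem_ofPred_eq, hW.eq_zero_of_mem_frontier hHc hx]
    exact hδ.le
  have hWZ : ∀ x ∈ W, x ∉ Z → x ∈ N → δ < H x := fun x hx hxZ hxN =>
    not_le.1 fun h => hxZ ⟨⟨hxN, subset_closure hx⟩, h⟩
  have huv' : ∀ x ∈ W, x ∉ Z → u x = v x := fun x hx hxZ => huv x hx (hWZ x hx hxZ)
  have hWφ : ∀ x ∈ W, ∀ t, φ t x ∈ W := fun x hx t => hW.flow_mem hR hH hv hφ hx t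
  have huc : CompleteField u :=
    completeField_of_eq_flow hRc hφ hWo hWφ hZc hMZ hu.smooth huv' huR
  obtain ⟨γ, T, hγ, hT, hγ0, hγT⟩ := hlink _ u (hF.inv hFpos) (fun x => inv_pos.2 (hFpos x))
    (hu.isReeb_rescale_inv hlam hF hFpos) huc
  refine ⟨γ 0, hγ0, ?_⟩
  have hx₀ := hKW hγ0
  have hγTM : γ T ∈ frontier W := by
    simp only [negCore, mem_iInter] at hγT
    obtain ⟨y, hy, hyT⟩ := hγT 1 one_pos
    rw [← hyT]
    exact hW.flow_mem_frontier hR hH hv hφ hy.1 1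
  have hcc := hφ.continuous_left (γ 0)
  -- Otherwise `γ` agrees with the trajectory of φ up to time `T` and stays in W, but it ends on M.
  have hhit : ∃ t ∈ Icc 0 T, φ t (γ 0) ∈ Z := by
    by_contra! hcon
    obtain ⟨a, b, ha, hb, hab⟩ := exists_Ioo_of_Icc_subset hT
      (hZc.isClosed.isOpen_compl.preimage hcc) hcon
    have hφu : IsMIntegralCurveOn (fun t => φ t (γ 0)) u (Ioo a b) := fun t ht => by
      rw [huv' _ (hWφ _ hx₀ t) (hab ht)]
      exact (hφ.integral (γ 0) t).hasMFDerivWithinAt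
    have heq := isMIntegralCurveOn_Ioo_eqOn_of_contMDiff_boundaryless (t₀ := 0)
      (by constructor <;> linarith)
      hu.smooth.contMDiff_one (hγ.isMIntegralCurveOn _) hφu (hφ.map_zero _).symm
    refine disjoint_left.1 hMW hγTM ?_
    rw [heq ⟨by linarith, hb⟩]
    exact hWφ _ hx₀ T
  obtain ⟨t₁, ⟨ht₁, hyZ⟩, hmin⟩ := (isCompact_Icc.inter_right
    (hZc.isClosed.preimage hcc)).exists_isLeast hhit
  have hyW := hWφ _ hx₀ t₁
  have ht₁pos : 0 < t₁ := by
    refine lt_of_le_of_ne ht₁.1 ?_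
    rintro rfl
    rw [mem_preimage, hφ.map_zero] at hyZ
    exact (hNO hyZ.1.1).2 hγ0
  -- The entry is through the level H = δ, not through the frontier of `N`, where H > δ.
  have hyN : φ t₁ (γ 0) ∈ interior N := by
    by_contra hcon
    exact absurd (hNδ _ ⟨⟨subset_closure hyZ.1.1, hcon⟩, hyZ.1.2⟩) (not_lt.2 hyZ.2)
  -- Just before `t₁` the trajectory is in `N` but not in `Z`, which forces H > δ.
  have hev : ∀ᶠ t in 𝓝[<] t₁, H (φ t₁ (γ 0)) ≤ H (φ t (γ 0)) := by
    have h1 : ∀ᶠ t in 𝓝[<] t₁, φ t (γ 0) ∈ interior N :=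
      (hcc.tendsto t₁).mono_left nhdsWithin_le_nhds (isOpen_interior.mem_nhds hyN)
    filter_upwards [h1, Ioo_mem_nhdsLT ht₁pos] with t htN ht
    refine le_trans hyZ.2 (hWZ _ (hWφ _ hx₀ t) (fun htZ => ?_) (interior_subset htN)).le
    exact absurd (hmin ⟨⟨ht.1.le, ht.2.le.trans ht₁.2⟩, htZ⟩) (not_le.2 ht.2)
  have hle := nonpos_of_hasDerivAt_of_eventually_le
    (hasDerivAt_hamiltonian_flow hR hH hv hφ (γ 0) t₁) hev
  have hy0 : dFun H (φ t₁ (γ 0)) (R (φ t₁ (γ 0))) ≤ 0 := by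
    by_contra! hcon
    exact absurd (mul_pos (hW.pos hyW) hcon) (not_lt.2 hle)
  have hyO : φ t₁ (γ 0) ∈ O := (hNO hyZ.1.1).1.resolve_right (not_lt.2 hy0)
  refine ((hOlim _ ⟨hyO, hyW⟩).comp
    (tendsto_atTop_add_const_right atTop (-t₁) tendsto_id)).congr fun t => ?_
  simp only [Function.comp_apply, id]
  rw [← hφ.map_add hv.smooth, neg_add_cancel_right]

end

end ContactDyn

end

theorem theorem2p8 (n : ℕ) {X : Type*} [TopologicalSpace X] [T2Space X]
    [SecondCountableTopology X] [ChartedSpace (EuclideanSpace ℝ (Fin (2 * n + 1))) X]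
    [IsManifold (𝓡 (2 * n + 1)) ∞ X]
    -- the contact form, with its complete Reeb field
    (lam : ContactDyn.OneForm (EuclideanSpace ℝ (Fin (2 * n + 1))) X)
    (R : ContactDyn.VField (EuclideanSpace ℝ (Fin (2 * n + 1))) X)
    (hlam : ContactDyn.IsContactForm lam) (hR : ContactDyn.IsReeb lam R)
    (hRc : ContactDyn.CompleteField R)
    -- the contact Hamiltonian, with its contact vector field and complete flow
    (H : X → ℝ) (hH : ContactDyn.SmoothFun (EuclideanSpace ℝ (Fin (2 * n + 1))) H)
    (v : ContactDyn.VField (EuclideanSpace ℝ (Fin (2 * n + 1))) X)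
    (hv : ContactDyn.IsContactField lam H v)
    (φ : ℝ → X → X) (hφ : ContactDyn.IsFlow φ v)
    -- the nodal domain, with smooth compact boundary
    (W : Set X) (hW : ContactDyn.IsPositiveDomain H W)
    (hM : ContactDyn.IsSubmanifold (EuclideanSpace ℝ (Fin (2 * n + 1))) 1 (frontier W))
    (hMc : IsCompact (frontier W))
    (hΓ : ContactDyn.CrossesIntoNeg H R v φ (frontier W))
    (Λ : Set X) (hcore : ContactDyn.negCore H R φ (frontier W) = Λ)
    (hΛ : ContactDyn.IsLegendrian n lam Λ)
    (K : Set X) (hK : ContactDyn.IsLegendrian n lam K) (hKW : K ⊆ W)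
    (hlink : ContactDyn.RobustlyInterlinked n lam K Λ) :
    ∃ x ∈ K, Tendsto (fun t => φ t x) atTop (𝓝ˢ Λ) := by
  have : LocallyCompactSpace X := Manifold.locallyCompact_of_finiteDimensional (𝓡 (2 * n + 1))
  have : LocallyConnectedSpace X :=
    ChartedSpace.locallyConnectedSpace (EuclideanSpace ℝ (Fin (2 * n + 1))) X
  subst hcore
  refine ContactDyn.exists_tendsto_negCore hlam.smooth hR hRc hH hv hφ hW hMc hΓ hK.isCompact hKW
    fun g R' hg hpos hR' hR'c => ?_
  obtain ⟨⟨_, μ, _, h⟩, _⟩ := hlink g R' hg hpos hR' hR'c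
  -- For the rescaled form the Hamiltonian is the constant 1: its contact field is the Reeb field
  -- `R'`, and a = 1.
  obtain ⟨γ, T, hγ, hT, _, hγ0, hγT⟩ := h (fun _ => 1) R' 1 contMDiff_const hR'.isContactField_one
    hR'c one_pos (fun _ => le_rfl) ⟨1, fun _ => le_rfl⟩
  exact ⟨γ, T, hγ, hT, hγ0, hγT⟩
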